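/- Let $N\ge 1$, let $K$ be an algebraically closed field of characteristic $0$ and let $\theta\in K$ (for instance $K=\mathbb C$ and $\theta>0$, or $\theta$ a formal variable and $K$ an algebraic closure of $\mathbb C(\theta)$). On $K[x_1,\dots,x_N]$ the symmetric group $S_N$ acts by permuting the variables. Consider the Dunkl operators and the Heckman–Polychronakos operators $$\mathcal D_i=\frac{\partial}{\partial x_i}+\theta\sum_{j\ne i}\frac{1-(i,j)}{x_i-x_j},\qquad \mathcal P_m=\sum_{i=1}^N (x_i\mathcal D_i)^m,\quad m\ge 1 .$$ For $\lambda=(\lambda_1\ge\dots\ge\lambda_N\ge 0)$ let $V_\lambda$ be the span of the monomials $x^\gamma$ with $\gamma^+=\lambda$, where $\gamma^+$ is the non-increasing rearrangement of $\gamma$. For an irreducible representation $\tau$ of $S_N$ over $K$ (up to isomorphism; these are labelled by the partitions $\tau\vdash N$) let $V_{\lambda;\tau}$ be the $\tau$-isotypical component of $V_\lambda$, and let $\chi^\tau$ be the character of $\tau$. Write $\mu\preceq\lambda$ if $\sum_{i=1}^N\mu_i=\sum_{i=1}^N\lambda_i$ and $\sum_{i=1}^k\mu_i\le\sum_{i=1}^k\lambda_i$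 for all $1\le k\le N$. Let $F_{\lambda,\tau,i}$ (for all $\lambda$, $\tau$ and $1\le i\le\dim V_{\lambda;\tau}$) be non-zero joint eigenfunctions of all $\mathcal P_m$, $m\ge 1$, which together span $K[x_1,\dots,x_N]$ and are such that: 1. $F_{\lambda,\tau,i}$ is homogeneous of degree $|\lambda|=\lambda_1+\dots+\lambda_N$; 2. every monomial $x^\gamma$ with non-zero coefficient in $F_{\lambda,\tau,i}$ has $\gamma^+\preceq\lambda$; 3. the part of $F_{\lambda,\tau,i}$ spanned by the monomials in $V_\lambda$ belongs to $V_{\lambda;\tau}$. For $K=\mathbb C$ and every real $\theta>0$ such a system exists. **Theorem.** Let $\mathrm{eig}_m(\lambda,\tau,i)$ be the eigenvalue of $\mathcal P_m$ on $F_{\lambda,\tau,i}$. Suppose that the parts of $\lambda$ are distinct, $\lambda_1>\dots>\lambda_N\ge 0$, and put $\ell_i=\lambda_i+\theta(N-i)$. Then for every irreducible representation $\tau$ of $S_N$ and every $m\ge 1$, $$\sum_{i=1}^{\dim V_{\lambda;\tau}}\mathrm{eig}_m(\lambda,\tau,i)=\dim\tau\sum_{k=1}^{\min(m+1,N)}(-\theta)^{k-1}\,h^{(k)}_{m+1-k}(\ell_1,\dots,\ell_N)\,\chi^\tau\bigl((1\,2\,\dots\,k)\bigr),$$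 where $h^{(r)}_m(x_1,\dots,x_N)=\sum_{\{i_1<\dots<i_r\}\subset\{1,\dots,N\}}h_m(x_{i_1},\dots,x_{i_r})$, $h_m$ is the complete homogeneous symmetric function, and $(1\,2\,\dots\,k)\in S_N$ is the $k$-cycle fixing the remaining $N-k$ points. -/

import Mathlib

namespace HeckmanPolychronakos

open MvPolynomial

noncomputable section

/-! ### Divided differences, Dunkl operators, Heckman-Polychronakos operators -/

theorem sub_dvd_sub_rename_swap (K : Type*) [Field K] {N : ℕ} (i j : Fin N)
    (f : MvPolynomial (Fin N) K) :
    (X i - X j : MvPolynomial (Fin N) K) ∣ f - rename (Equiv.swap i j) f := by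
  set q := Ideal.Quotient.mkₐ K (Ideal.span {(X i - X j : MvPolynomial (Fin N) K)}) with hq
  have hij : q (X i) = q (X j) := by
    rw [hq, Ideal.Quotient.mkₐ_eq_mk, Ideal.Quotient.eq]
    exact Ideal.mem_span_singleton_self _
  have key : q.comp (rename (Equiv.swap i j)) = q := by
    apply MvPolynomial.algHom_ext
    intro k
    simp only [AlgHom.comp_apply, rename_X]
    rcases eq_or_ne k i with rfl | hki
    · rw [Equiv.swap_apply_left, hij]
    · rcases eq_or_ne k j with rfl | hkj
      · rw [Equiv.swap_apply_right, hij]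
      · rw [Equiv.swap_apply_of_ne_of_ne hki hkj]
  have h := congrArg (fun g => g f) key
  rw [← Ideal.mem_span_singleton, ← Ideal.Quotient.eq, ← Ideal.Quotient.mkₐ_eq_mk K]
  exact h.symm

/-- The polynomial `(f - (i,j) f) / (x_i - x_j)` for `i ≠ j` (and `0` for `i = j`). -/
def divDiffFun {K : Type*} [Field K] {N : ℕ} (i j : Fin N) (f : MvPolynomial (Fin N) K) :
    MvPolynomial (Fin N) K :=
  if i = j then 0 else (sub_dvd_sub_rename_swap K i j f).choose

theorem mul_divDiffFun {K : Type*} [Field K] {N : ℕ} (i j : Fin N)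
    (f : MvPolynomial (Fin N) K) :
    (X i - X j) * divDiffFun i j f = f - rename (Equiv.swap i j) f := by
  unfold divDiffFun
  split_ifs with h
  · subst h
    simp
  · exact (sub_dvd_sub_rename_swap K i j f).choose_spec.symm

theorem divDiffFun_eq {K : Type*} [Field K] {N : ℕ} {i j : Fin N} (hij : i ≠ j)
    {f g : MvPolynomial (Fin N) K}
    (h : (X i - X j) * g = f - rename (Equiv.swap i j) f) : divDiffFun i j f = g := by
  have hne : (X i - X j : MvPolynomial (Fin N) K) ≠ 0 :=
    sub_ne_zero.mpr fun h => hij (X_injective h)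
  exact mul_left_cancel₀ hne ((mul_divDiffFun i j f).trans h.symm)

/-- The linear operator `(1 - (i,j)) / (x_i - x_j)` on polynomials, for `i ≠ j`. -/
def divDiff (K : Type*) [Field K] {N : ℕ} (i j : Fin N) :
    Module.End K (MvPolynomial (Fin N) K) where
  toFun := divDiffFun i j
  map_add' f g := by
    by_cases hij : i = j
    · simp [divDiffFun, hij]
    · apply divDiffFun_eq hij
      rw [mul_add, mul_divDiffFun, mul_divDiffFun, map_add]
      ring
  map_smul' c f := by
    by_cases hij : i = j
    · simp [divDiffFun, hij]
    · apply divDiffFun_eq hij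
      rw [RingHom.id_apply, mul_smul_comm, mul_divDiffFun, map_smul, smul_sub]

/-- The Dunkl operator `D_i = ∂/∂x_i + θ ∑_{j ≠ i} (1 - (i,j)) / (x_i - x_j)`. -/
def dunkl {K : Type*} [Field K] {N : ℕ} (θ : K) (i : Fin N) :
    Module.End K (MvPolynomial (Fin N) K) :=
  (pderiv i : Derivation K (MvPolynomial (Fin N) K) (MvPolynomial (Fin N) K)).toLinearMap
    + θ • ∑ j ∈ Finset.univ.erase i, divDiff K i j

/-- The Heckman-Polychronakos operator `P_m = ∑_i (x_i D_i) ^ m`. -/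
def hpOp {K : Type*} [Field K] {N : ℕ} (θ : K) (m : ℕ) :
    Module.End K (MvPolynomial (Fin N) K) :=
  ∑ i : Fin N, (LinearMap.mulLeft K (X i : MvPolynomial (Fin N) K) * dunkl θ i) ^ m

/-! ### Partitions, dominance order, complete homogeneous functions -/

/-- Partitions `λ_1 ≥ ... ≥ λ_N ≥ 0` with at most `N` non-zero parts. -/
abbrev Part (N : ℕ) : Type := {p : Fin N → ℕ // Antitone p}

/-- `mu ⪯ la` in the dominance order (equality allowed): the sums agree and each partial sum of
`mu` is at most that of `la`. -/
def Dominated {N : ℕ} (mu la : Part N) : Prop :=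
  ∑ i, mu.1 i = ∑ i, la.1 i ∧
    ∀ k : Fin N, ∑ i ∈ Finset.Iic k, mu.1 i ≤ ∑ i ∈ Finset.Iic k, la.1 i

/-- The non-increasing rearrangement `γ⁺` of a degree sequence. -/
def sortDesc {N : ℕ} (γ : Fin N →₀ ℕ) : Part N :=
  ⟨fun i => γ (Tuple.sort γ (Fin.rev i)),
    fun _ _ h => Tuple.monotone_sort γ (Fin.rev_le_rev.mpr h)⟩

/-- `h^{(r)}_m(x_1, ..., x_N)`: the sum over all `r`-element sets `A` of indices of the complete
homogeneous symmetric function `h_m` in the variables `x_a`, `a ∈ A`. -/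
def hSub {K : Type*} [Field K] {N : ℕ} (r m : ℕ) (x : Fin N → K) : K :=
  ∑ A ∈ Finset.powersetCard r (Finset.univ : Finset (Fin N)),
    aeval (fun a : A => x a) (hsymm A K m)

/-! ### Representations of the symmetric group -/

/-- An irreducible (finite-dimensional) representation of `S_N` over `K`, in coordinates. -/
structure Irrep (K : Type*) [Field K] (N : ℕ) where
  dim : ℕ
  rep : Representation K (Equiv.Perm (Fin N)) (Fin dim → K)
  irreducible : rep.IsIrreducible

/-- Isomorphism of irreducible representations. -/
instance Irrep.isoSetoid (K : Type*) [Field K] (N : ℕ) : Setoid (Irrep K N) where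
  r ρ σ := Nonempty (ρ.rep.Equiv σ.rep)
  iseqv :=
    { refl := fun ρ => ⟨Representation.Equiv.refl ρ.rep⟩
      symm := fun ⟨e⟩ => ⟨e.symm⟩
      trans := fun ⟨e⟩ ⟨f⟩ => ⟨e.trans f⟩ }

/-- Isomorphism classes of irreducible representations of `S_N` over `K`. -/
abbrev IrrepClass (K : Type*) [Field K] (N : ℕ) : Type _ := Quotient (Irrep.isoSetoid K N)

/-- `dim τ`. -/
def IrrepClass.dim {K : Type*} [Field K] {N : ℕ} (τ : IrrepClass K N) : ℕ :=
  (Quotient.out τ).dim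

/-- A representation in the class `τ`. -/
def IrrepClass.rep {K : Type*} [Field K] {N : ℕ} (τ : IrrepClass K N) :
    Representation K (Equiv.Perm (Fin N)) (Fin (Quotient.out τ).dim → K) :=
  (Quotient.out τ).rep

/-- The character `χ^τ`. -/
def IrrepClass.char {K : Type*} [Field K] {N : ℕ} (τ : IrrepClass K N)
    (g : Equiv.Perm (Fin N)) : K :=
  τ.rep.character g

/-- `S_N` acts on polynomials by permuting the variables. -/
def polyRep (K : Type*) [Field K] (N : ℕ) :
    Representation K (Equiv.Perm (Fin N)) (MvPolynomial (Fin N) K) where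
  toFun g := (rename g : MvPolynomial (Fin N) K →ₐ[K] MvPolynomial (Fin N) K).toLinearMap
  map_one' := by
    apply LinearMap.ext
    intro f
    exact rename_id_apply f
  map_mul' g h := by
    apply LinearMap.ext
    intro f
    exact (rename_rename h g f).symm

/-- `V_λ`: the span of the monomials `x^γ` with `γ⁺ = λ`. -/
def V (K : Type*) [Field K] {N : ℕ} (la : Part N) : Submodule K (MvPolynomial (Fin N) K) :=
  Submodule.span K {f | ∃ γ : Fin N →₀ ℕ, sortDesc γ = la ∧ f = monomial γ 1}

/-- `V_{λ;τ}`: the isotypical component of `τ` in `V_λ`, that is, the sum of all `S_N`-invariant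
subspaces of `V_λ` that are isomorphic to `τ`. -/
def isotypic {K : Type*} [Field K] {N : ℕ} (la : Part N) (τ : IrrepClass K N) :
    Submodule K (MvPolynomial (Fin N) K) :=
  sSup {W | ∃ U : Subrepresentation (polyRep K N), U.toSubmodule = W ∧ W ≤ V K la ∧
    Nonempty (U.toRepresentation.Equiv τ.rep)}

/-- The cycle `(1 2 … k)` in `S_N`, fixing the other `N - k` points (for `k ≤ N`). -/
def firstCycle (N k : ℕ) : Equiv.Perm (Fin N) :=
  ((List.finRange N).take k).formPerm

/-! ### Systems of eigenfunctions -/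

open Classical in
/-- The part of `f` spanned by monomials in `V_λ`. -/
def leadingPart {K : Type*} [Field K] {N : ℕ} (la : Part N) (f : MvPolynomial (Fin N) K) :
    MvPolynomial (Fin N) K :=
  ∑ γ ∈ f.support.filter (fun γ => sortDesc γ = la), monomial γ (coeff γ f)

/-- A non-zero joint eigenfunction of all `P_m`, `m ≥ 1`. -/
def IsJointEigenfunction {K : Type*} [Field K] {N : ℕ} (θ : K)
    (f : MvPolynomial (Fin N) K) : Prop :=
  f ≠ 0 ∧ ∀ m : ℕ, 1 ≤ m → ∃ c : K, hpOp θ m f = c • f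

/-- Families of polynomials `F_{λ,τ,i}`, `1 ≤ i ≤ dim V_{λ;τ}`. -/
abbrev Family (K : Type*) [Field K] (N : ℕ) : Type _ :=
  (la : Part N) → (τ : IrrepClass K N) → Fin (Module.finrank K (isotypic la τ)) →
    MvPolynomial (Fin N) K

/-- The family `F_{λ,τ,i}` is a classifying system of joint eigenfunctions of the operators
`P_m`. -/
structure IsEigensystem {K : Type*} [Field K] {N : ℕ} (θ : K) (F : Family K N) : Prop where
  eigen : ∀ la τ i, IsJointEigenfunction θ (F la τ i)
  homogeneous : ∀ la τ i, (F la τ i).IsHomogeneous (∑ j, la.1 j)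
  dominated : ∀ la τ i, ∀ γ ∈ (F la τ i).support, Dominated (sortDesc γ) la
  leading : ∀ la τ i, leadingPart la (F la τ i) ∈ isotypic la τ
  span_eq_top : Submodule.span K {f | ∃ la τ i, f = F la τ i} = ⊤

/-- The shifted parts `ℓ_i = λ_i + θ (N - i)`, `1 ≤ i ≤ N`. Indices in `Fin N` start from `0`. -/
def shifted {K : Type*} [Field K] {N : ℕ} (θ : K) (la : Part N) (i : Fin N) : K :=
  (la.1 i : K) + θ * ((N : K) - ((i : ℕ) + 1 : K))

end

end HeckmanPolychronakos

namespace HeckmanPolychronakos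

open MvPolynomial

noncomputable section

/-! ### Relations between Dunkl operators -/

section Relations

variable {K : Type*} [Field K] {N : ℕ}

/-! Formula. Order monomials `x^γ` by dominance of `γ⁺`. Each `x_i D_i` is triangular: up to
monomials strictly below `λ` it acts on `V_λ` by `leadOp` (`lead_heck`), hence `P_m` acts by
`leadHp`, which commutes with `S_N` on `V_λ`. Since the `F_{λ,τ,i}` span all polynomials, their
leading parts form a basis of `V_{λ;τ}` (`IsEigensystem.V_le_span_lead`, `IsEigensystem.leadBasis`).
The sum of the eigenvalues is therefore the trace of `leadHp` on `V_{λ;τ}`, that is, the trace on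
`V_λ` of `leadHp` composed with the isotypical projection.

If the parts of `λ` are distinct, `V_λ` is the regular representation with basis `x^(gλ)`, and for
`i = g p` the operator `leadOp i` sends `x^(gλ)` to `ℓ_p x^(gλ) - θ ∑_{q<p} x^(g(p q)λ)`
(`leadOp_orbitMonomial`). In the new monomial the same `i` is the image of `q`, so the `m`-th power
is a sum over descending walks of `m` steps: a step stays at the current index `r` with weight `ℓ_r`
or jumps to a smaller index with weight `-θ`. The walks with vertex set `A`, `|A| = k`, have total
weight `(-θ)^(k-1) h_{m+1-k}(ℓ_a : a ∈ A)`, and their transpositions multiply to a `k`-cycle that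
depends only on `A` (`leadOp_pow_orbitMonomial`). Thus `leadHp` is right multiplication by an
element of the group algebra; right multiplication by `c` has trace `dim τ · χ^τ(c)` on the
`τ`-component of the regular representation (`trace_leadHpV_isotypicSumV`).

Existence for `K = ℂ`, `θ > 0`. The exchange relation `heck_commutator` makes the `P_m` commute
(`commute_hpOp`). They are symmetric for the Hermitian form `(f̄(D) g)(0)`, which is positive
definite (`hermForm_self_pos`), so they are jointly diagonalizable on every finite-dimensional
invariant space of homogeneous polynomials. Applied to the polynomials below `λ` with leading part
in `V_{λ;τ}`, this gives joint eigenfunctions whose leading parts span `V_{λ;τ}`, and triangularity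
shows that together they span everything. -/

theorem mul_divDiff (i j : Fin N) (f : MvPolynomial (Fin N) K) :
    (X i - X j) * divDiff K i j f = f - rename (Equiv.swap i j) f :=
  mul_divDiffFun i j f

theorem divDiff_eq {i j : Fin N} (hij : i ≠ j) {f g : MvPolynomial (Fin N) K}
    (h : (X i - X j) * g = f - rename (Equiv.swap i j) f) : divDiff K i j f = g :=
  divDiffFun_eq hij h

theorem divDiff_C {i j : Fin N} (hij : i ≠ j) (a : K) : divDiff K i j (C a) = 0 :=
  divDiff_eq hij (by simp)

theorem divDiff_X_mul_left {i j : Fin N} (hij : i ≠ j) (f : MvPolynomial (Fin N) K) :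
    divDiff K i j (X i * f) = X i * divDiff K i j f + rename (Equiv.swap i j) f := by
  apply divDiff_eq hij
  have := mul_divDiff i j f
  simp only [map_mul, rename_X, Equiv.swap_apply_left]
  linear_combination X i * this

theorem divDiff_X_mul_right {i j : Fin N} (hij : i ≠ j) (f : MvPolynomial (Fin N) K) :
    divDiff K i j (X j * f) = X j * divDiff K i j f - rename (Equiv.swap i j) f := by
  apply divDiff_eq hij
  have := mul_divDiff i j f
  simp only [map_mul, rename_X, Equiv.swap_apply_right]
  linear_combination X j * this

theorem divDiff_X_mul_of_ne {i j k : Fin N} (hij : i ≠ j) (hki : k ≠ i) (hkj : k ≠ j)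
    (f : MvPolynomial (Fin N) K) : divDiff K i j (X k * f) = X k * divDiff K i j f := by
  apply divDiff_eq hij
  have := mul_divDiff i j f
  simp only [map_mul, rename_X, Equiv.swap_apply_of_ne_of_ne hki hkj]
  linear_combination X k * this

theorem rename_divDiff {i j : Fin N} (hij : i ≠ j) (g : Equiv.Perm (Fin N))
    (f : MvPolynomial (Fin N) K) :
    divDiff K (g i) (g j) (rename g f) = rename g (divDiff K i j f) := by
  apply divDiff_eq (g.injective.ne hij)
  have := congrArg (rename g) (mul_divDiff i j f)
  simp only [map_mul, map_sub, rename_X, rename_rename] at this ⊢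
  rw [this]
  congr 2
  rw [← Equiv.Perm.coe_mul, ← Equiv.Perm.coe_mul, Equiv.swap_apply_apply g i j]
  simp

variable (θ : K)

theorem dunkl_apply (i : Fin N) (f : MvPolynomial (Fin N) K) :
    dunkl θ i f = pderiv i f + θ • ∑ j ∈ Finset.univ.erase i, divDiff K i j f := by
  simp [dunkl, LinearMap.sum_apply]

theorem dunkl_C (i : Fin N) (a : K) : dunkl θ i (C a) = 0 := by
  rw [dunkl_apply, Finset.sum_eq_zero fun j hj => divDiff_C (Finset.ne_of_mem_erase hj).symm a]
  simp

theorem dunkl_rename (g : Equiv.Perm (Fin N)) (i : Fin N) (f : MvPolynomial (Fin N) K) :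
    dunkl θ (g i) (rename g f) = rename g (dunkl θ i f) := by
  rw [dunkl_apply, dunkl_apply, pderiv_rename g.injective, map_add, map_smul, map_sum]
  congr 2
  refine (Finset.sum_equiv g ?_ ?_).symm
  · simp
  · intro j hj
    exact (rename_divDiff (Finset.ne_of_mem_erase hj).symm g f).symm

theorem dunkl_rename_swap (i j : Fin N) (f : MvPolynomial (Fin N) K) :
    dunkl θ i (rename (Equiv.swap i j) f) = rename (Equiv.swap i j) (dunkl θ j f) := by
  simpa using dunkl_rename θ (Equiv.swap i j) j f

theorem dunkl_rename_swap_of_ne {i j k : Fin N} (hj : i ≠ j) (hk : i ≠ k)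
    (f : MvPolynomial (Fin N) K) :
    dunkl θ i (rename (Equiv.swap j k) f) = rename (Equiv.swap j k) (dunkl θ i f) := by
  simpa [Equiv.swap_apply_of_ne_of_ne hj hk] using dunkl_rename θ (Equiv.swap j k) i f

theorem dunkl_X_mul_of_ne {i k : Fin N} (hki : k ≠ i) (f : MvPolynomial (Fin N) K) :
    dunkl θ i (X k * f) = X k * dunkl θ i f - θ • rename (Equiv.swap i k) f := by
  have hk : k ∈ Finset.univ.erase i := Finset.mem_erase.mpr ⟨hki, Finset.mem_univ k⟩
  have hrest : ∑ j ∈ (Finset.univ.erase i).erase k, divDiff K i j (X k * f) =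
      X k * ∑ j ∈ (Finset.univ.erase i).erase k, divDiff K i j f := by
    rw [Finset.mul_sum]
    refine Finset.sum_congr rfl fun j hj => ?_
    simp only [Finset.mem_erase] at hj
    exact divDiff_X_mul_of_ne hj.2.1.symm hki hj.1.symm f
  rw [dunkl_apply, dunkl_apply, ← Finset.add_sum_erase _ _ hk, ← Finset.add_sum_erase _ _ hk,
    hrest, divDiff_X_mul_right hki.symm]
  simp only [Derivation.leibniz, pderiv_X_of_ne hki, smul_eq_C_mul, smul_eq_mul]
  ring

theorem dunkl_X_mul_self (i : Fin N) (f : MvPolynomial (Fin N) K) :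
    dunkl θ i (X i * f) = X i * dunkl θ i f + f +
      θ • ∑ j ∈ Finset.univ.erase i, rename (Equiv.swap i j) f := by
  have hrest : ∑ j ∈ Finset.univ.erase i, divDiff K i j (X i * f) =
      X i * ∑ j ∈ Finset.univ.erase i, divDiff K i j f +
        ∑ j ∈ Finset.univ.erase i, rename (Equiv.swap i j) f := by
    rw [Finset.mul_sum, ← Finset.sum_add_distrib]
    exact Finset.sum_congr rfl fun j hj => divDiff_X_mul_left (Finset.ne_of_mem_erase hj).symm f
  rw [dunkl_apply, dunkl_apply, hrest]
  simp only [Derivation.leibniz, pderiv_X_self, smul_eq_C_mul, smul_eq_mul]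
  ring

/-- Moving both operators past `X i` leaves transposition terms. Those with `swap i l`, `l ≠ j`,
agree because such a swap commutes with `D_j`; those with `swap i j` exchange `D_i` and `D_j` and
cancel on each side separately. -/
theorem dunkl_dunkl_X_mul {i j : Fin N} (hij : i ≠ j) {f : MvPolynomial (Fin N) K}
    (ih : dunkl θ i (dunkl θ j f) = dunkl θ j (dunkl θ i f)) :
    dunkl θ i (dunkl θ j (X i * f)) = dunkl θ j (dunkl θ i (X i * f)) := by
  have hj : j ∈ Finset.univ.erase i := Finset.mem_erase.mpr ⟨hij.symm, Finset.mem_univ j⟩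
  have hsum : ∑ l ∈ (Finset.univ.erase i).erase j,
        dunkl θ j (rename (Equiv.swap i l) f) =
      ∑ l ∈ (Finset.univ.erase i).erase j, rename (Equiv.swap i l) (dunkl θ j f) := by
    refine Finset.sum_congr rfl fun l hl => ?_
    simp only [Finset.mem_erase] at hl
    exact dunkl_rename_swap_of_ne θ hij.symm hl.1.symm f
  rw [dunkl_X_mul_of_ne θ hij, dunkl_X_mul_self]
  simp only [map_add, map_sub, map_smul, map_sum]
  rw [dunkl_X_mul_self, dunkl_X_mul_of_ne θ hij, ← Finset.add_sum_erase _ _ hj,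
    ← Finset.add_sum_erase _ _ hj, hsum, Equiv.swap_comm j i, dunkl_rename_swap,
    Equiv.swap_comm i j, dunkl_rename_swap, ih]
  simp only [smul_eq_C_mul]
  ring

/-- The commutator kills constants and commutes with multiplication by every variable, hence
vanishes. -/
theorem dunkl_comm (i j : Fin N) (f : MvPolynomial (Fin N) K) :
    dunkl θ i (dunkl θ j f) = dunkl θ j (dunkl θ i f) := by
  rcases eq_or_ne i j with rfl | hij
  · rfl
  induction f using MvPolynomial.induction_on with
  | C a => simp only [dunkl_C, map_zero]
  | add p q hp hq => simp only [map_add, hp, hq]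
  | mul_X p k ih =>
    rw [mul_comm]
    rcases eq_or_ne k i with rfl | hki
    · exact dunkl_dunkl_X_mul θ hij ih
    rcases eq_or_ne k j with rfl | hkj
    · exact (dunkl_dunkl_X_mul θ hij.symm ih.symm).symm
    rw [dunkl_X_mul_of_ne θ hki, dunkl_X_mul_of_ne θ hkj, map_sub, map_sub, map_smul, map_smul,
      dunkl_X_mul_of_ne θ hki, dunkl_X_mul_of_ne θ hkj, ih, dunkl_rename_swap_of_ne θ hij hki.symm,
      dunkl_rename_swap_of_ne θ hij.symm hkj.symm]
    simp only [smul_eq_C_mul]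
    ring

/-- The operator `x_i D_i`. -/
def heck (i : Fin N) : Module.End K (MvPolynomial (Fin N) K) :=
  LinearMap.mulLeft K (X i : MvPolynomial (Fin N) K) * dunkl θ i

theorem heck_apply (i : Fin N) (f : MvPolynomial (Fin N) K) :
    heck θ i f = X i * dunkl θ i f := rfl

theorem hpOp_eq (m : ℕ) : hpOp (N := N) θ m = ∑ i, heck θ i ^ m := rfl

theorem polyRep_apply (g : Equiv.Perm (Fin N)) (f : MvPolynomial (Fin N) K) :
    polyRep K N g f = rename g f := rfl

theorem polyRep_heck (g : Equiv.Perm (Fin N)) (i : Fin N) :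
    polyRep K N g * heck θ i = heck θ (g i) * polyRep K N g := by
  refine LinearMap.ext fun f => ?_
  simp only [Module.End.mul_apply, heck_apply, polyRep_apply, map_mul, rename_X, dunkl_rename]

theorem polyRep_heck_pow (g : Equiv.Perm (Fin N)) (i : Fin N) (m : ℕ) :
    polyRep K N g * heck θ i ^ m = heck θ (g i) ^ m * polyRep K N g := by
  exact SemiconjBy.pow_right (polyRep_heck θ g i) m

theorem polyRep_hpOp (g : Equiv.Perm (Fin N)) (m : ℕ) :
    polyRep K N g * hpOp θ m = hpOp θ m * polyRep K N g := by
  rw [hpOp_eq, Finset.mul_sum, Finset.sum_mul]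
  exact Finset.sum_equiv g (by simp) fun i _ => polyRep_heck_pow θ g i m

/-- Since the `D_i` commute, only the transposition terms from moving `D_i` past `X j` and `D_j`
past `X i` survive. This exchange relation and the conjugation by transpositions are all that
commutativity of the `P_m` needs. -/
theorem heck_commutator {i j : Fin N} (hij : i ≠ j) :
    heck θ i * heck θ j - heck θ j * heck θ i =
      (-θ) • ((heck θ i - heck θ j) * polyRep K N (Equiv.swap i j)) := by
  refine LinearMap.ext fun f => ?_
  simp only [Module.End.mul_apply, LinearMap.sub_apply, LinearMap.smul_apply, heck_apply,
    polyRep_apply]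
  rw [dunkl_X_mul_of_ne θ hij.symm, dunkl_X_mul_of_ne θ hij, dunkl_comm θ i j,
    dunkl_rename_swap, Equiv.swap_comm i j, dunkl_rename_swap]
  simp only [smul_eq_C_mul, map_neg]
  ring

end Relations

/-! ### Power sums in a ring with exchange relations -/

section PowerSums

variable {K R ι : Type*} [Field K] [Ring R] [Algebra K R]
  {A : ι → R} {S : ι → ι → R} {c : K}

theorem commutator_pow_right (hSA : ∀ i j, i ≠ j → S i j * A j = A i * S i j)
    (hA : ∀ i j, i ≠ j → A i * A j - A j * A i = c • ((A i - A j) * S i j))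
    {i j : ι} (hij : i ≠ j) (n : ℕ) :
    A i * A j ^ n - A j ^ n * A i = c • ((A i ^ n - A j ^ n) * S i j) := by
  induction n with
  | zero => simp
  | succ n ih =>
    calc A i * A j ^ (n + 1) - A j ^ (n + 1) * A i
        = (A i * A j ^ n - A j ^ n * A i) * A j + A j ^ n * (A i * A j - A j * A i) := by
          rw [pow_succ]; noncomm_ring
      _ = c • ((A i ^ n - A j ^ n) * (S i j * A j) + A j ^ n * ((A i - A j) * S i j)) := by
          rw [ih, hA i j hij, smul_add, smul_mul_assoc, mul_smul_comm, mul_assoc]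
      _ = _ := by
          rw [hSA i j hij, pow_succ, pow_succ]; congr 1; noncomm_ring

theorem commutator_pow_pow (hSA : ∀ i j, i ≠ j → S i j * A j = A i * S i j)
    (hSA' : ∀ i j, i ≠ j → S i j * A i = A j * S i j)
    (hA : ∀ i j, i ≠ j → A i * A j - A j * A i = c • ((A i - A j) * S i j))
    {i j : ι} (hij : i ≠ j) (a b : ℕ) :
    A i ^ a * A j ^ b - A j ^ b * A i ^ a =
      c • ∑ k ∈ Finset.range a, (A i ^ (k + b) * A j ^ (a - 1 - k) * S i j -
        A i ^ k * A j ^ (a - 1 - k + b) * S i j) := by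
  have hpow : ∀ a, S i j * A i ^ a = A j ^ a * S i j := fun a =>
    (show SemiconjBy (S i j) (A i) (A j) from hSA' i j hij).pow_right a
  induction a with
  | zero => simp
  | succ a ih =>
    calc A i ^ (a + 1) * A j ^ b - A j ^ b * A i ^ (a + 1)
        = A i * (A i ^ a * A j ^ b - A j ^ b * A i ^ a) +
          (A i * A j ^ b - A j ^ b * A i) * A i ^ a := by
          rw [pow_succ' (A i) a]; noncomm_ring
      _ = c • (A i * ∑ k ∈ Finset.range a, (A i ^ (k + b) * A j ^ (a - 1 - k) * S i j -
            A i ^ k * A j ^ (a - 1 - k + b) * S i j) +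
            (A i ^ b - A j ^ b) * (S i j * A i ^ a)) := by
          rw [ih, commutator_pow_right hSA hA hij, smul_add, smul_mul_assoc, mul_smul_comm,
            mul_assoc]
      _ = _ := by
          rw [hpow, Finset.sum_range_succ', Finset.mul_sum]
          congr 2
          · refine Finset.sum_congr rfl fun k hk => ?_
            have : a + 1 - 1 - (k + 1) = a - 1 - k := by omega
            rw [this, show k + 1 + b = (k + b) + 1 by ring, pow_succ' (A i), pow_succ' (A i)]
            noncomm_ring
          · simp only [zero_add, pow_zero, one_mul, add_tsub_cancel_right, tsub_zero,
              pow_add]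
            rw [(Commute.refl (A j)).pow_pow a b |>.eq]
            noncomm_ring

/-- The versions with and without `S` must be proved together: the commutator formula lowers the
total degree by one and multiplies by `S`, and `S` squares to `1`, so each version in degree `M + 1`
follows from the other in degree `M`. -/
theorem sum_offDiag_pow_symm [Fintype ι] (hSA : ∀ i j, i ≠ j → S i j * A j = A i * S i j)
    (hSA' : ∀ i j, i ≠ j → S i j * A i = A j * S i j)
    (hS : ∀ i j, S i j = S j i) (hSS : ∀ i j, S i j * S i j = 1)
    (hA : ∀ i j, i ≠ j → A i * A j - A j * A i = c • ((A i - A j) * S i j)) (M a b : ℕ)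
    (hab : a + b = M) :
    ∑ p ∈ (Finset.univ : Finset ι).offDiag, A p.1 ^ a * A p.2 ^ b =
        ∑ p ∈ (Finset.univ : Finset ι).offDiag, A p.1 ^ b * A p.2 ^ a ∧
      ∑ p ∈ (Finset.univ : Finset ι).offDiag, A p.1 ^ a * A p.2 ^ b * S p.1 p.2 =
        ∑ p ∈ (Finset.univ : Finset ι).offDiag, A p.1 ^ b * A p.2 ^ a * S p.1 p.2 := by
  have hswap : ∀ f : ι × ι → R, ∑ p ∈ (Finset.univ : Finset ι).offDiag, f p =
      ∑ p ∈ (Finset.univ : Finset ι).offDiag, f p.swap := fun f =>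
    Finset.sum_equiv (Equiv.prodComm ι ι) (by simp [eq_comm]) (by simp)
  induction M generalizing a b with
  | zero =>
    obtain ⟨rfl, rfl⟩ : a = 0 ∧ b = 0 := by omega
    exact ⟨rfl, rfl⟩
  | succ M ih =>
    -- The reflection `k ↦ a - 1 - k` followed by the symmetry of `g` turns the first half of the
    -- sum into the second.
    have hrefl : ∀ g : ℕ → ℕ → R, (∀ p q, p + q = M → g p q = g q p) →
        ∑ k ∈ Finset.range a, (g (k + b) (a - 1 - k) - g k (a - 1 - k + b)) = 0 := by
      intro g hg
      rw [Finset.sum_sub_distrib, sub_eq_zero, ← Finset.sum_range_reflect]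
      refine Finset.sum_congr rfl fun k hk => ?_
      have hk := Finset.mem_range.mp hk
      rw [hg _ _ (by omega), show a - 1 - (a - 1 - k) = k by omega]
    constructor
    · rw [hswap fun p => A p.1 ^ b * A p.2 ^ a, ← sub_eq_zero, ← Finset.sum_sub_distrib]
      simp only [Prod.fst_swap, Prod.snd_swap]
      rw [Finset.sum_congr rfl fun p hp =>
        commutator_pow_pow hSA hSA' hA (Finset.mem_offDiag.mp hp).2.2 a b]
      rw [← Finset.smul_sum, Finset.sum_comm]
      simp only [Finset.sum_sub_distrib] at hrefl ⊢
      rw [hrefl (fun p q => ∑ x ∈ (Finset.univ : Finset ι).offDiag,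
        A x.1 ^ p * A x.2 ^ q * S x.1 x.2) fun p q h => (ih p q h).2, smul_zero]
    · rw [hswap fun p => A p.1 ^ b * A p.2 ^ a * S p.1 p.2, ← sub_eq_zero,
        ← Finset.sum_sub_distrib]
      have : ∀ p ∈ (Finset.univ : Finset ι).offDiag,
          A p.1 ^ a * A p.2 ^ b * S p.1 p.2 - A p.swap.1 ^ b * A p.swap.2 ^ a * S p.swap.1 p.swap.2
          = c • ∑ k ∈ Finset.range a, (A p.1 ^ (k + b) * A p.2 ^ (a - 1 - k) -
            A p.1 ^ k * A p.2 ^ (a - 1 - k + b)) := by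
        intro p hp
        rw [Prod.fst_swap, Prod.snd_swap, hS p.2 p.1, ← sub_mul,
          commutator_pow_pow hSA hSA' hA (Finset.mem_offDiag.mp hp).2.2 a b, smul_mul_assoc,
          Finset.sum_mul]
        congr 1
        refine Finset.sum_congr rfl fun k _ => ?_
        rw [sub_mul, mul_assoc, hSS, mul_one, mul_assoc (A p.1 ^ k * _), hSS, mul_one]
      rw [Finset.sum_congr rfl this, ← Finset.smul_sum, Finset.sum_comm]
      simp only [Finset.sum_sub_distrib] at hrefl ⊢
      rw [hrefl (fun p q => ∑ x ∈ (Finset.univ : Finset ι).offDiag,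
        A x.1 ^ p * A x.2 ^ q) fun p q h => (ih p q h).1, smul_zero]

/-- In the product of two power sums the diagonal terms depend only on `a + b`; the off-diagonal
ones are symmetric by `sum_offDiag_pow_symm`. -/
theorem commute_sum_pow [Fintype ι] [DecidableEq ι] (hSA : ∀ i j, i ≠ j → S i j * A j = A i * S i j)
    (hSA' : ∀ i j, i ≠ j → S i j * A i = A j * S i j)
    (hS : ∀ i j, S i j = S j i) (hSS : ∀ i j, S i j * S i j = 1)
    (hA : ∀ i j, i ≠ j → A i * A j - A j * A i = c • ((A i - A j) * S i j)) (a b : ℕ) :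
    Commute (∑ i, A i ^ a) (∑ i, A i ^ b) := by
  have key : ∀ a b : ℕ, (∑ i, A i ^ a) * (∑ i, A i ^ b) =
      ∑ i, A i ^ (a + b) + ∑ p ∈ (Finset.univ : Finset ι).offDiag, A p.1 ^ a * A p.2 ^ b := by
    intro a b
    rw [Finset.sum_mul_sum, ← Finset.sum_product', ← Finset.diag_union_offDiag,
      Finset.sum_union (Finset.disjoint_diag_offDiag _), Finset.sum_diag]
    simp [pow_add]
  rw [commute_iff_eq, key, key, add_comm a b,
    (sum_offDiag_pow_symm hSA hSA' hS hSS hA _ a b rfl).1]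

end PowerSums

theorem commute_hpOp {K : Type*} [Field K] {N : ℕ} (θ : K) (a b : ℕ) :
    Commute (hpOp (N := N) θ a) (hpOp θ b) := by
  refine commute_sum_pow (A := heck θ) (S := fun i j => polyRep K N (Equiv.swap i j)) (c := -θ)
    ?_ ?_ ?_ ?_ ?_ a b
  · intro i j _
    simpa using polyRep_heck θ (Equiv.swap i j) j
  · intro i j _
    simpa using polyRep_heck θ (Equiv.swap i j) i
  · intro i j
    simp only [Equiv.swap_comm]
  · intro i j
    rw [← map_mul, Equiv.swap_mul_self, map_one]
  · intro i j hij
    exact heck_commutator θ hij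

/-! ### The dominance order -/

section Dominance

variable {N : ℕ}

theorem sortDesc_mapDomain (g : Equiv.Perm (Fin N)) (γ : Fin N →₀ ℕ) :
    sortDesc (γ.mapDomain g) = sortDesc γ := by
  apply Subtype.ext
  funext i
  have h : (⇑(γ.mapDomain g) : Fin N → ℕ) = γ ∘ g.symm := by
    funext j
    exact Finsupp.mapDomain_equiv_apply γ j
  change (γ.mapDomain g ∘ Tuple.sort (γ.mapDomain g)) (Fin.rev i) = (γ ∘ Tuple.sort γ) (Fin.rev i)
  rw [h, Tuple.comp_perm_comp_sort_eq_comp_sort]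

/-- The permutation that sorts `γ`. -/
def sortPerm (γ : Fin N →₀ ℕ) : Equiv.Perm (Fin N) := Fin.revPerm.trans (Tuple.sort γ)

theorem sortDesc_apply (γ : Fin N →₀ ℕ) (i : Fin N) : (sortDesc γ).1 i = γ (sortPerm γ i) := rfl

theorem mapDomain_sortPerm (γ : Fin N →₀ ℕ) :
    (Finsupp.equivFunOnFinite.symm (sortDesc γ).1).mapDomain (sortPerm γ) = γ := by
  ext i
  rw [Finsupp.mapDomain_equiv_apply]
  simp [sortDesc_apply]

theorem sum_comp_sortDesc (γ : Fin N →₀ ℕ) (φ : ℕ → ℕ) :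
    ∑ i, φ ((sortDesc γ).1 i) = ∑ i, φ (γ i) := by
  simp only [sortDesc_apply]
  exact Equiv.sum_comp (sortPerm γ) fun i => φ (γ i)

theorem sum_sortDesc (γ : Fin N →₀ ℕ) : ∑ i, (sortDesc γ).1 i = ∑ i, γ i :=
  sum_comp_sortDesc γ id

/-- Indices of `T` beyond `k` have values at most `p k`, those up to `k` missing from `T` have
values at least `p k`, and there are equally many of both. -/
theorem sum_le_sum_Iic_of_antitone {p : Fin N → ℕ} (hp : Antitone p) (k : Fin N)
    {T : Finset (Fin N)} (hT : T.card = (Finset.Iic k).card) :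
    ∑ i ∈ T, p i ≤ ∑ i ∈ Finset.Iic k, p i := by
  rw [← Finset.sum_inter_add_sum_sdiff T (Finset.Iic k),
    ← Finset.sum_inter_add_sum_sdiff (Finset.Iic k) T, Finset.inter_comm (Finset.Iic k) T]
  refine Nat.add_le_add_left ?_ _
  have h1 : ∑ i ∈ T \ Finset.Iic k, p i ≤ (T \ Finset.Iic k).card • p k :=
    Finset.sum_le_card_nsmul _ _ _ fun i hi => hp (by
      simp only [Finset.mem_sdiff, Finset.mem_Iic, not_le] at hi
      exact hi.2.le)
  have h2 : (Finset.Iic k \ T).card • p k ≤ ∑ i ∈ Finset.Iic k \ T, p i :=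
    Finset.card_nsmul_le_sum _ _ _ fun i hi => hp (by
      simp only [Finset.mem_sdiff, Finset.mem_Iic] at hi
      exact hi.1)
  rw [Finset.card_sdiff_comm hT] at h1
  exact h1.trans h2

theorem sum_le_sum_sortDesc (γ : Fin N →₀ ℕ) (k : Fin N) {T : Finset (Fin N)}
    (hT : T.card = (Finset.Iic k).card) :
    ∑ i ∈ T, γ i ≤ ∑ i ∈ Finset.Iic k, (sortDesc γ).1 i := by
  have h := sum_le_sum_Iic_of_antitone (sortDesc γ).2 k
    (T := T.map (sortPerm γ).symm.toEmbedding) (by rw [Finset.card_map, hT])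
  rw [Finset.sum_map] at h
  simpa [sortDesc_apply] using h

theorem sum_sortDesc_Iic (γ : Fin N →₀ ℕ) (k : Fin N) :
    ∑ i ∈ Finset.Iic k, (sortDesc γ).1 i =
      ∑ i ∈ (Finset.Iic k).map (sortPerm γ).toEmbedding, γ i := by
  rw [Finset.sum_map]
  rfl

/-- The partial sums of `γ⁺` are the maximal sums of `γ` over sets of given size, so dominance can
be tested without sorting. -/
theorem dominated_sortDesc {γ δ : Fin N →₀ ℕ} (hsum : ∑ i, γ i = ∑ i, δ i)
    (h : ∀ T : Finset (Fin N), ∃ T' : Finset (Fin N), T'.card = T.card ∧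
      ∑ i ∈ T, γ i ≤ ∑ i ∈ T', δ i) : Dominated (sortDesc γ) (sortDesc δ) := by
  refine ⟨by rw [sum_sortDesc, sum_sortDesc, hsum], fun k => ?_⟩
  obtain ⟨T', hc, hle⟩ := h ((Finset.Iic k).map (sortPerm γ).toEmbedding)
  rw [sum_sortDesc_Iic]
  exact hle.trans (sum_le_sum_sortDesc δ k (by rw [hc, Finset.card_map]))

theorem Dominated.refl (la : Part N) : Dominated la la := ⟨rfl, fun _ => le_rfl⟩

theorem Dominated.trans {la mu nu : Part N} (h : Dominated la mu) (h' : Dominated mu nu) :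
    Dominated la nu :=
  ⟨h.1.trans h'.1, fun k => (h.2 k).trans (h'.2 k)⟩

/-- The sum of the partial sums, a strictly monotone function for the dominance order. -/
def partialSums (la : Part N) : ℕ := ∑ k, ∑ i ∈ Finset.Iic k, la.1 i

theorem eq_of_partialSums_eq {la mu : Part N}
    (h : ∀ k, ∑ i ∈ Finset.Iic k, la.1 i = ∑ i ∈ Finset.Iic k, mu.1 i) : la = mu := by
  apply Subtype.ext
  funext k
  induction k using WellFoundedLT.induction with
  | ind k ih =>
    have hk := h k
    have hI : ∑ i ∈ Finset.Iio k, la.1 i = ∑ i ∈ Finset.Iio k, mu.1 i :=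
      Finset.sum_congr rfl fun i hi => ih i (Finset.mem_Iio.mp hi)
    rw [← Finset.Iio_insert, Finset.sum_insert (by simp), Finset.sum_insert (by simp), hI] at hk
    exact Nat.add_right_cancel hk

theorem Dominated.partialSums_lt {la mu : Part N} (h : Dominated la mu) (hne : la ≠ mu) :
    partialSums la < partialSums mu := by
  refine lt_of_le_of_ne (Finset.sum_le_sum fun k _ => h.2 k) fun heq => hne ?_
  refine eq_of_partialSums_eq fun k => ?_
  exact (Finset.sum_eq_sum_iff_of_le fun k _ => h.2 k).mp heq k (Finset.mem_univ k)

theorem Dominated.antisymm {la mu : Part N} (h : Dominated la mu) (h' : Dominated mu la) :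
    la = mu :=
  eq_of_partialSums_eq fun k => le_antisymm (h.2 k) (h'.2 k)

theorem partialSums_le (la : Part N) : partialSums la ≤ N * ∑ i, la.1 i := by
  calc partialSums la ≤ ∑ _k : Fin N, ∑ i, la.1 i :=
        Finset.sum_le_sum fun k _ => Finset.sum_le_sum_of_subset (Finset.subset_univ _)
    _ = _ := by simp

/-- Downward induction on the dominance order. -/
theorem Dominated.induction_up {P : Part N → Prop}
    (h : ∀ la, (∀ mu, Dominated la mu → la ≠ mu → P mu) → P la) (la : Part N) : P la := by
  induction hn : N * ∑ i, la.1 i - partialSums la using Nat.strong_induction_on generalizing la with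
  | _ n ih =>
    refine h la fun mu hmu hne => ih _ ?_ mu rfl
    have h1 := hmu.partialSums_lt hne
    have h2 := partialSums_le mu
    -- Comparable partitions have the same total, so both measures refer to the same upper bound.
    rw [← hmu.1] at h2 ⊢
    omega

/-- Upward induction on the dominance order. -/
theorem Dominated.induction_down {P : Part N → Prop}
    (h : ∀ la, (∀ mu, Dominated mu la → mu ≠ la → P mu) → P la) (la : Part N) : P la := by
  induction hn : partialSums la using Nat.strong_induction_on generalizing la with
  | _ n ih =>
    exact h la fun mu hmu hne => ih _ (hn ▸ hmu.partialSums_lt hne) mu rfl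

/-- The exponents of `(x_i x_j)^b ∏ x_l^(δ_l)` split between `x_i` and `x_j` are strictly
dominated by the extreme ones. -/
theorem dominated_split {i j : Fin N} (hij : i ≠ j) {δ : Fin N →₀ ℕ} (hδ : δ i = δ j) {c n : ℕ}
    (hc : 0 < c) (hcn : c < n) :
    Dominated (sortDesc (δ + Finsupp.single i (n - c) + Finsupp.single j c))
        (sortDesc (δ + Finsupp.single i n)) ∧
      sortDesc (δ + Finsupp.single i (n - c) + Finsupp.single j c) ≠
        sortDesc (δ + Finsupp.single i n) := by
  classical
  have hs1 : ∀ (T : Finset (Fin N)) (k : Fin N) (a : ℕ),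
      ∑ l ∈ T, Finsupp.single k a l = if k ∈ T then a else 0 := by
    intro T k a
    simp only [Finsupp.single_apply]
    rw [Finset.sum_ite_eq]
  constructor
  · apply dominated_sortDesc
    · simp only [Finsupp.add_apply, Finset.sum_add_distrib, hs1, Finset.mem_univ, if_true]
      omega
    · intro T
      by_cases hj : j ∈ T
      · by_cases hi : i ∈ T
        · refine ⟨T, rfl, ?_⟩
          simp only [Finsupp.add_apply, Finset.sum_add_distrib, hs1, hi, hj, if_true]
          omega
        -- Replacing `j` by `i` gains `n - c`, as the common part `δ` has equal exponents there.
        · refine ⟨insert i (T.erase j), ?_, ?_⟩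
          · rw [Finset.card_insert_of_notMem (by simp [hi]), Finset.card_erase_add_one hj]
          · have h1 : ∑ l ∈ T, δ l = δ j + ∑ l ∈ T.erase j, δ l :=
              (Finset.add_sum_erase T _ hj).symm
            have h2 : ∑ l ∈ insert i (T.erase j), δ l = δ i + ∑ l ∈ T.erase j, δ l :=
              Finset.sum_insert (by simp [hi])
            simp only [Finsupp.add_apply, Finset.sum_add_distrib, hs1, hi, hj, if_true, if_false,
              Finset.mem_insert_self, h1, h2, hδ]
            omega
      · refine ⟨T, rfl, ?_⟩
        simp only [Finsupp.add_apply, Finset.sum_add_distrib, hs1, hj, if_false]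
        split_ifs <;> omega
  -- The sum of squares is invariant under sorting, and it grows by `2 c (n - c) > 0` when the
  -- exponents are pushed to the extremes.
  · intro heq
    have h := congrArg (fun p : Part N => ∑ l, (p.1 l) ^ 2) heq
    simp only [sum_comp_sortDesc _ (· ^ 2)] at h
    have hj : j ∈ Finset.univ.erase i := by simp [hij.symm]
    rw [← Finset.add_sum_erase _ _ (Finset.mem_univ i), ← Finset.add_sum_erase _ _ hj,
      ← Finset.add_sum_erase Finset.univ (fun l => (δ + Finsupp.single i n) l ^ 2)
        (Finset.mem_univ i), ← Finset.add_sum_erase _ _ hj] at h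
    have hrest : ∑ l ∈ (Finset.univ.erase i).erase j,
        (δ + Finsupp.single i (n - c) + Finsupp.single j c) l ^ 2 =
        ∑ l ∈ (Finset.univ.erase i).erase j, (δ + Finsupp.single i n) l ^ 2 := by
      refine Finset.sum_congr rfl fun l hl => ?_
      simp only [Finset.mem_erase] at hl
      simp [hl.1.symm, hl.2.1.symm]
    rw [hrest] at h
    simp only [Finsupp.add_apply, Finsupp.single_eq_same, Finsupp.single_eq_of_ne hij,
      Finsupp.single_eq_of_ne hij.symm, hδ, add_zero] at h
    obtain ⟨d, rfl⟩ := Nat.exists_eq_add_of_lt hcn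
    have : c + d + 1 - c = d + 1 := by omega
    rw [this] at h
    have hpos : 0 < c * (d + 1) := by positivity
    nlinarith

end Dominance

/-! ### Triangularity of the operators `x_i D_i` -/

section Triangular

variable {K : Type*} [Field K] {N : ℕ}

theorem restrictSupport_induction {s : Set (Fin N →₀ ℕ)} {W : Submodule K (MvPolynomial (Fin N) K)}
    (h : ∀ γ ∈ s, monomial γ (1 : K) ∈ W) : restrictSupport K s ≤ W := by
  rw [restrictSupport_eq_span, Submodule.span_le]
  rintro _ ⟨γ, hγ, rfl⟩
  exact h γ hγ

theorem monomial_mem_restrictSupport_of_mem {s : Set (Fin N →₀ ℕ)} {γ : Fin N →₀ ℕ} (h : γ ∈ s) :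
    monomial γ (1 : K) ∈ restrictSupport K s := by
  rw [restrictSupport_eq_span]
  exact Submodule.subset_span ⟨γ, h, rfl⟩

variable (K) in
/-- The span of the monomials `x^γ` with `γ⁺ ⪯ λ`. -/
def domSpan (la : Part N) : Submodule K (MvPolynomial (Fin N) K) :=
  restrictSupport K {γ | Dominated (sortDesc γ) la}

variable (K) in
/-- The span of the monomials `x^γ` with `γ⁺ ≺ λ`. -/
def lowSpan (la : Part N) : Submodule K (MvPolynomial (Fin N) K) :=
  restrictSupport K {γ | Dominated (sortDesc γ) la ∧ sortDesc γ ≠ la}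

theorem V_eq_restrictSupport (la : Part N) : V K la = restrictSupport K {γ | sortDesc γ = la} := by
  rw [restrictSupport_eq_span, V]
  congr 1
  ext f
  simp [eq_comm]

theorem lowSpan_le_domSpan (la : Part N) : lowSpan K la ≤ domSpan K la :=
  restrictSupport_mono _ fun _ h => h.1

theorem V_le_domSpan (la : Part N) : V K la ≤ domSpan K la := by
  rw [V_eq_restrictSupport]
  exact restrictSupport_mono _ fun γ (h : sortDesc γ = la) => h ▸ Dominated.refl _

theorem coeff_leadingPart (la : Part N) (f : MvPolynomial (Fin N) K) (γ : Fin N →₀ ℕ)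
    [Decidable (sortDesc γ = la)] :
    coeff γ (leadingPart la f) = if sortDesc γ = la then coeff γ f else 0 := by
  classical
  simp only [leadingPart, coeff_sum, coeff_monomial, Finset.sum_ite_eq', Finset.mem_filter,
    mem_support_iff]
  by_cases h : sortDesc γ = la <;> by_cases h' : coeff γ f = 0 <;> simp [h, h']

variable (K) in
/-- The projection to `V_λ` along the other monomials. -/
def lead (la : Part N) : Module.End K (MvPolynomial (Fin N) K) where
  toFun := leadingPart la
  map_add' f g := by
    classical
    ext γ
    simp only [coeff_add, coeff_leadingPart]
    split_ifs <;> simp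
  map_smul' c f := by
    classical
    ext γ
    simp only [coeff_smul, coeff_leadingPart, RingHom.id_apply]
    split_ifs <;> simp

theorem coeff_lead (la : Part N) (f : MvPolynomial (Fin N) K) (γ : Fin N →₀ ℕ)
    [Decidable (sortDesc γ = la)] :
    coeff γ (lead K la f) = if sortDesc γ = la then coeff γ f else 0 :=
  coeff_leadingPart la f γ

theorem lead_mem_V (la : Part N) (f : MvPolynomial (Fin N) K) : lead K la f ∈ V K la := by
  classical
  rw [V_eq_restrictSupport, mem_restrictSupport_iff]
  intro γ hγ
  rw [Finset.mem_coe, mem_support_iff, coeff_lead] at hγ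
  by_contra h
  exact hγ (if_neg h)

theorem lead_eq_self {la : Part N} {f : MvPolynomial (Fin N) K} (hf : f ∈ V K la) :
    lead K la f = f := by
  classical
  ext γ
  rw [coeff_lead]
  split_ifs with h
  · rfl
  · rw [V_eq_restrictSupport, mem_restrictSupport_iff] at hf
    by_contra h'
    exact h (hf (mem_support_iff.mpr (Ne.symm h')))

theorem lead_eq_zero {la : Part N} {f : MvPolynomial (Fin N) K}
    (hf : ∀ γ ∈ f.support, sortDesc γ ≠ la) : lead K la f = 0 := by
  classical
  ext γ
  rw [coeff_lead, coeff_zero]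
  split_ifs with h
  · by_contra h'
    exact hf γ (mem_support_iff.mpr h') h
  · rfl

theorem lead_eq_zero_of_mem_lowSpan {la : Part N} {f : MvPolynomial (Fin N) K}
    (hf : f ∈ lowSpan K la) : lead K la f = 0 :=
  lead_eq_zero fun _ hγ => (hf hγ).2

theorem lead_eq_zero_of_mem_domSpan {la mu : Part N} {f : MvPolynomial (Fin N) K}
    (hf : f ∈ domSpan K mu) (h : ¬ Dominated la mu) : lead K la f = 0 :=
  lead_eq_zero fun _ hγ heq => h (heq ▸ hf hγ)

theorem mem_lowSpan_of_lead_eq_zero {la : Part N} {f : MvPolynomial (Fin N) K}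
    (hf : f ∈ domSpan K la) (h : lead K la f = 0) : f ∈ lowSpan K la := by
  classical
  intro γ hγ
  refine ⟨hf hγ, fun heq => ?_⟩
  have h1 := coeff_lead la f γ
  rw [h, if_pos heq, coeff_zero] at h1
  exact mem_support_iff.mp hγ h1.symm

theorem lead_monomial_of_ne {la : Part N} {γ : Fin N →₀ ℕ} (h : sortDesc γ ≠ la) :
    lead K la (monomial γ 1) = 0 :=
  lead_eq_zero fun δ hδ => by
    rw [Finset.mem_singleton.mp (support_monomial_subset hδ)]
    exact h

theorem monomial_mem_V (γ : Fin N →₀ ℕ) : monomial γ (1 : K) ∈ V K (sortDesc γ) :=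
  Submodule.subset_span ⟨γ, rfl, rfl⟩

theorem rename_mem_V {la : Part N} (g : Equiv.Perm (Fin N)) {f : MvPolynomial (Fin N) K}
    (hf : f ∈ V K la) : rename g f ∈ V K la := by
  suffices V K la ≤ (V K la).comap (polyRep K N g) from this hf
  rw [V, Submodule.span_le]
  rintro _ ⟨γ, rfl, rfl⟩
  rw [SetLike.mem_coe, Submodule.mem_comap, polyRep_apply, rename_monomial,
    ← sortDesc_mapDomain g γ]
  exact monomial_mem_V _

theorem rename_lead (la : Part N) (g : Equiv.Perm (Fin N)) (f : MvPolynomial (Fin N) K) :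
    rename g (lead K la f) = lead K la (rename g f) := by
  induction f using MvPolynomial.induction_on' with
  | monomial γ a =>
    rw [← mul_one a, ← smul_eq_mul, ← smul_monomial, map_smul, map_smul, map_smul, map_smul]
    congr 1
    by_cases h : sortDesc γ = la
    · subst h
      rw [lead_eq_self (monomial_mem_V γ), lead_eq_self (rename_mem_V g (monomial_mem_V γ))]
    · rw [lead_monomial_of_ne h, rename_monomial,
        lead_monomial_of_ne (by rwa [sortDesc_mapDomain]), map_zero]
  | add p q hp hq => simp only [map_add, hp, hq]

theorem divDiff_mul_of_rename_eq {i j : Fin N} (hij : i ≠ j) {g : MvPolynomial (Fin N) K}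
    (hg : rename (Equiv.swap i j) g = g) (f : MvPolynomial (Fin N) K) :
    divDiff K i j (g * f) = g * divDiff K i j f := by
  apply divDiff_eq hij
  rw [map_mul, hg, mul_left_comm, mul_divDiff, mul_sub]

/-- A geometric sum; because of the factor `X i` the end term `X j ^ n` is absent, so `c = 0` is the
only extreme term. -/
theorem X_mul_divDiff_X_pow {i j : Fin N} (hij : i ≠ j) (n : ℕ) :
    X i * divDiff K i j (X i ^ n) = ∑ c ∈ Finset.range n, X i ^ (n - c) * X j ^ c := by
  have h : divDiff K i j (X i ^ n) = ∑ c ∈ Finset.range n, X j ^ c * X i ^ (n - 1 - c) := by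
    apply divDiff_eq hij
    have := geom_sum₂_mul (X j : MvPolynomial (Fin N) K) (X i) n
    rw [map_pow, rename_X, Equiv.swap_apply_left]
    linear_combination -this
  rw [h, Finset.mul_sum]
  refine Finset.sum_congr rfl fun c hc => ?_
  have : n - c = (n - 1 - c) + 1 := by have := Finset.mem_range.mp hc; omega
  rw [this, pow_succ]
  ring

theorem divDiff_X_pow_right {i j : Fin N} (hij : i ≠ j) (n : ℕ) :
    divDiff K i j (X j ^ n) = - divDiff K i j (X i ^ n) := by
  apply divDiff_eq hij
  rw [mul_neg, mul_divDiff, map_pow, map_pow, rename_X, rename_X, Equiv.swap_apply_left,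
    Equiv.swap_apply_right]
  ring

/-- The leading part of `x_i (1 - (i,j)) / (x_i - x_j) x^γ`. -/
def swapTerm (K : Type*) [Field K] (γ : Fin N →₀ ℕ) (i j : Fin N) : MvPolynomial (Fin N) K :=
  if γ j < γ i then monomial γ 1
  else if γ i < γ j then - monomial (γ.mapDomain (Equiv.swap i j)) 1 else 0

/-- The term `c = 0` is the monomial subtracted; all others are strictly lower by `dominated_split`.
-/
theorem X_pow_mul_sum_split {i j : Fin N} (hij : i ≠ j) {δ : Fin N →₀ ℕ} (hδ : δ i = δ j) {n : ℕ}
    (hn : 0 < n) :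
    monomial δ (1 : K) * (∑ c ∈ Finset.range n, X i ^ (n - c) * X j ^ c) -
        monomial (δ + Finsupp.single i n) 1 ∈ lowSpan K (sortDesc (δ + Finsupp.single i n)) := by
  have hterm : ∀ c, monomial δ (1 : K) * (X i ^ (n - c) * X j ^ c) =
      monomial (δ + Finsupp.single i (n - c) + Finsupp.single j c) 1 := by
    intro c
    rw [X_pow_eq_monomial, X_pow_eq_monomial, ← mul_assoc, monomial_mul, monomial_mul]
    simp
  rw [Finset.mul_sum, Finset.sum_congr rfl fun c _ => hterm c, Finset.sum_range_eq_add_Ico _ hn]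
  simp only [tsub_zero, Finsupp.single_zero, add_zero, add_sub_cancel_left]
  refine Submodule.sum_mem _ fun c hc => ?_
  obtain ⟨hc1, hc2⟩ := Finset.mem_Ico.mp hc
  exact monomial_mem_restrictSupport_of_mem (dominated_split hij hδ hc1 hc2)

theorem mapDomain_swap_eq_self {i j : Fin N} {δ : Fin N →₀ ℕ} (hδ : δ i = δ j) :
    δ.mapDomain (Equiv.swap i j) = δ := by
  ext k
  rw [Finsupp.mapDomain_equiv_apply, Equiv.symm_swap]
  rcases eq_or_ne k i with rfl | hi
  · rw [Equiv.swap_apply_left, hδ]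
  rcases eq_or_ne k j with rfl | hj
  · rw [Equiv.swap_apply_right, hδ]
  rw [Equiv.swap_apply_of_ne_of_ne hi hj]

theorem rename_swap_monomial {i j : Fin N} {δ : Fin N →₀ ℕ} (hδ : δ i = δ j) (a : K) :
    rename (Equiv.swap i j) (monomial δ a) = monomial δ a := by
  rw [rename_monomial, mapDomain_swap_eq_self hδ]

theorem exists_eq_add_single {i j : Fin N} (hij : i ≠ j) {γ : Fin N →₀ ℕ} (h : γ j < γ i) :
    ∃ (δ : Fin N →₀ ℕ) (n : ℕ), δ i = δ j ∧ 0 < n ∧ γ = δ + Finsupp.single i n := by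
  have hle : Finsupp.single i (γ i - γ j) ≤ γ := Finsupp.single_le_iff.mpr (Nat.sub_le _ _)
  refine ⟨γ - Finsupp.single i (γ i - γ j), γ i - γ j, ?_, by omega, (tsub_add_cancel_of_le hle).symm⟩
  simp only [Finsupp.tsub_apply, Finsupp.single_eq_same, Finsupp.single_eq_of_ne hij.symm]
  omega

/-- Write `x^γ` as a monomial symmetric in `x_i, x_j`, which passes through the divided difference,
times a pure power of the variable with the larger exponent. What remains is the geometric sum of
`X_mul_divDiff_X_pow`, whose extreme term is always a power of `x_i`; for `γ i < γ j` this yields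
the swapped monomial with a minus sign. -/
theorem X_mul_divDiff_monomial {i j : Fin N} (hij : i ≠ j) (γ : Fin N →₀ ℕ) :
    X i * divDiff K i j (monomial γ 1) - swapTerm K γ i j ∈ lowSpan K (sortDesc γ) := by
  rcases lt_trichotomy (γ j) (γ i) with h | h | h
  · obtain ⟨δ, n, hδ, hn, rfl⟩ := exists_eq_add_single hij h
    rw [swapTerm, if_pos h]
    nth_rewrite 1 [← mul_one (1 : K)]
    rw [← monomial_mul, ← X_pow_eq_monomial,
      divDiff_mul_of_rename_eq hij (rename_swap_monomial hδ 1), mul_left_comm,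
      X_mul_divDiff_X_pow hij]
    exact X_pow_mul_sum_split hij hδ hn
  · have h0 : divDiff K i j (monomial γ 1) = 0 :=
      divDiff_eq hij (by rw [rename_swap_monomial h.symm, mul_zero, sub_self])
    rw [h0, swapTerm, if_neg h.not_lt, if_neg h.symm.not_lt, mul_zero, sub_zero]
    exact Submodule.zero_mem _
  · obtain ⟨δ, n, hδ, hn, rfl⟩ := exists_eq_add_single hij.symm h
    have hs : (δ + Finsupp.single j n).mapDomain (Equiv.swap i j) = δ + Finsupp.single i n := by
      rw [Finsupp.mapDomain_add, mapDomain_swap_eq_self hδ.symm, Finsupp.mapDomain_single,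
        Equiv.swap_apply_right]
    rw [← sortDesc_mapDomain (Equiv.swap i j) (δ + Finsupp.single j n), swapTerm, if_neg h.not_gt,
      if_pos h, hs]
    nth_rewrite 1 [← mul_one (1 : K)]
    rw [← monomial_mul, ← X_pow_eq_monomial,
      divDiff_mul_of_rename_eq hij (rename_swap_monomial hδ.symm 1), mul_left_comm,
      divDiff_X_pow_right hij, mul_neg, X_mul_divDiff_X_pow hij, mul_neg, neg_sub_neg, ← neg_sub]
    exact Submodule.neg_mem _ (X_pow_mul_sum_split hij hδ.symm hn)

variable (θ : K)

/-- The leading part of the operator `x_i D_i`. -/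
def leadOp (i : Fin N) : Module.End K (MvPolynomial (Fin N) K) :=
  (basisMonomials (Fin N) K).constr K fun γ =>
    (γ i : K) • monomial γ 1 + θ • ∑ j ∈ Finset.univ.erase i, swapTerm K γ i j

theorem leadOp_monomial (i : Fin N) (γ : Fin N →₀ ℕ) :
    leadOp θ i (monomial γ 1) =
      (γ i : K) • monomial γ 1 + θ • ∑ j ∈ Finset.univ.erase i, swapTerm K γ i j := by
  have := (basisMonomials (Fin N) K).constr_basis K (fun γ =>
    (γ i : K) • monomial γ 1 + θ • ∑ j ∈ Finset.univ.erase i, swapTerm K γ i j) γ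
  rwa [coe_basisMonomials] at this

theorem heck_monomial_sub_leadOp_mem (i : Fin N) (γ : Fin N →₀ ℕ) :
    heck θ i (monomial γ 1) - leadOp θ i (monomial γ 1) ∈ lowSpan K (sortDesc γ) := by
  have h : heck θ i (monomial γ 1) - leadOp θ i (monomial γ 1) =
      θ • ∑ j ∈ Finset.univ.erase i, (X i * divDiff K i j (monomial γ 1) - swapTerm K γ i j) := by
    rw [heck_apply, dunkl_apply, leadOp_monomial, mul_add, X_mul_pderiv_monomial,
      Finset.sum_sub_distrib, ← Finset.mul_sum, mul_smul_comm, smul_sub, Nat.cast_smul_eq_nsmul]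
    abel
  rw [h]
  exact Submodule.smul_mem _ _ (Submodule.sum_mem _ fun j hj =>
    X_mul_divDiff_monomial (Finset.ne_of_mem_erase hj).symm γ)

theorem swapTerm_mem_V (γ : Fin N →₀ ℕ) (i j : Fin N) : swapTerm K γ i j ∈ V K (sortDesc γ) := by
  rw [swapTerm]
  split_ifs
  · exact monomial_mem_V γ
  · refine Submodule.neg_mem _ ?_
    rw [← sortDesc_mapDomain (Equiv.swap i j) γ]
    exact monomial_mem_V _
  · exact Submodule.zero_mem _

theorem leadOp_mem_V {la : Part N} (i : Fin N) {f : MvPolynomial (Fin N) K} (hf : f ∈ V K la) :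
    leadOp θ i f ∈ V K la := by
  suffices V K la ≤ (V K la).comap (leadOp θ i) from this hf
  rw [V, Submodule.span_le]
  rintro _ ⟨γ, rfl, rfl⟩
  rw [SetLike.mem_coe, Submodule.mem_comap, leadOp_monomial]
  exact Submodule.add_mem _ (Submodule.smul_mem _ _ (monomial_mem_V γ))
    (Submodule.smul_mem _ _ (Submodule.sum_mem _ fun j _ => swapTerm_mem_V γ i j))

theorem domSpan_mono {la mu : Part N} (h : Dominated la mu) : domSpan K la ≤ domSpan K mu :=
  restrictSupport_mono _ fun _ h' => Dominated.trans h' h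

theorem lowSpan_le_of_dominated {la mu : Part N} (h : Dominated la mu) (hne : la ≠ mu) :
    domSpan K la ≤ lowSpan K mu :=
  restrictSupport_mono _ fun _ h' => ⟨Dominated.trans h' h, fun heq => hne (h.antisymm (heq ▸ h'))⟩

theorem heck_monomial_mem_domSpan (i : Fin N) (γ : Fin N →₀ ℕ) :
    heck θ i (monomial γ 1) ∈ domSpan K (sortDesc γ) := by
  rw [← sub_add_cancel (heck θ i (monomial γ 1)) (leadOp θ i (monomial γ 1))]
  exact Submodule.add_mem _ (lowSpan_le_domSpan _ (heck_monomial_sub_leadOp_mem θ i γ))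
    (V_le_domSpan _ (leadOp_mem_V θ i (monomial_mem_V γ)))

theorem heck_mem_domSpan {la : Part N} (i : Fin N) {f : MvPolynomial (Fin N) K}
    (hf : f ∈ domSpan K la) : heck θ i f ∈ domSpan K la := by
  suffices domSpan K la ≤ (domSpan K la).comap (heck θ i) from this hf
  exact restrictSupport_induction fun γ hγ => domSpan_mono hγ (heck_monomial_mem_domSpan θ i γ)

/-- Monomials strictly below `λ` stay strictly below, so the `λ`-part of the image depends only on
the `λ`-part of `f`. -/
theorem lead_heck {la : Part N} (i : Fin N) {f : MvPolynomial (Fin N) K}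
    (hf : f ∈ domSpan K la) : lead K la (heck θ i f) = leadOp θ i (lead K la f) := by
  suffices domSpan K la ≤ LinearMap.eqLocus (lead K la * heck θ i) (leadOp θ i * lead K la) from
    this hf
  refine restrictSupport_induction fun γ hγ => ?_
  rw [LinearMap.mem_eqLocus, Module.End.mul_apply, Module.End.mul_apply]
  by_cases h : sortDesc γ = la
  · subst h
    have h1 := lead_eq_zero_of_mem_lowSpan (heck_monomial_sub_leadOp_mem θ i γ)
    rw [map_sub, sub_eq_zero] at h1
    rw [h1, lead_eq_self (monomial_mem_V γ),
      lead_eq_self (leadOp_mem_V θ i (monomial_mem_V γ))]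
  · rw [lead_monomial_of_ne h, map_zero]
    exact lead_eq_zero_of_mem_lowSpan
      (lowSpan_le_of_dominated hγ h (heck_monomial_mem_domSpan θ i γ))

theorem heck_pow_mem_domSpan {la : Part N} (i : Fin N) (m : ℕ) {f : MvPolynomial (Fin N) K}
    (hf : f ∈ domSpan K la) : (heck θ i ^ m) f ∈ domSpan K la := by
  induction m with
  | zero => simpa using hf
  | succ m ih =>
    rw [pow_succ', Module.End.mul_apply]
    exact heck_mem_domSpan θ i ih

theorem lead_heck_pow {la : Part N} (i : Fin N) (m : ℕ) {f : MvPolynomial (Fin N) K}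
    (hf : f ∈ domSpan K la) : lead K la ((heck θ i ^ m) f) = (leadOp θ i ^ m) (lead K la f) := by
  induction m with
  | zero => simp
  | succ m ih =>
    rw [pow_succ', Module.End.mul_apply, lead_heck θ i (heck_pow_mem_domSpan θ i m hf), ih,
      pow_succ', Module.End.mul_apply]

/-- The leading part of the operator `P_m`. -/
def leadHp (m : ℕ) : Module.End K (MvPolynomial (Fin N) K) := ∑ i, leadOp θ i ^ m

theorem hpOp_mem_domSpan {la : Part N} (m : ℕ) {f : MvPolynomial (Fin N) K}
    (hf : f ∈ domSpan K la) : hpOp θ m f ∈ domSpan K la := by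
  rw [hpOp_eq, LinearMap.sum_apply]
  exact Submodule.sum_mem _ fun i _ => heck_pow_mem_domSpan θ i m hf

theorem lead_hpOp {la : Part N} (m : ℕ) {f : MvPolynomial (Fin N) K} (hf : f ∈ domSpan K la) :
    lead K la (hpOp θ m f) = leadHp θ m (lead K la f) := by
  rw [hpOp_eq, leadHp, LinearMap.sum_apply, LinearMap.sum_apply, map_sum]
  exact Finset.sum_congr rfl fun i _ => lead_heck_pow θ i m hf

theorem leadHp_eq_lead_hpOp {la : Part N} (m : ℕ) {f : MvPolynomial (Fin N) K} (hf : f ∈ V K la) :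
    leadHp θ m f = lead K la (hpOp θ m f) := by
  rw [lead_hpOp θ m (V_le_domSpan la hf), lead_eq_self hf]

theorem leadHp_mem_V {la : Part N} (m : ℕ) {f : MvPolynomial (Fin N) K} (hf : f ∈ V K la) :
    leadHp θ m f ∈ V K la := by
  rw [leadHp_eq_lead_hpOp θ m hf]
  exact lead_mem_V _ _

/-- Equivariance is inherited from `P_m` through the equivariant projection `lead`. -/
theorem rename_leadHp {la : Part N} (m : ℕ) (g : Equiv.Perm (Fin N))
    {f : MvPolynomial (Fin N) K} (hf : f ∈ V K la) :
    rename g (leadHp θ m f) = leadHp θ m (rename g f) := by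
  rw [leadHp_eq_lead_hpOp θ m hf, leadHp_eq_lead_hpOp θ m (rename_mem_V g hf), rename_lead]
  congr 1
  exact LinearMap.congr_fun (polyRep_hpOp θ g m) f

end Triangular

/-! ### Complete homogeneous symmetric functions of subsets -/

section CompleteHomogeneous

variable {K : Type*} [Field K]

/-- A multiset of size `n + 1` either contains `none`, which can be removed once, or lies in `σ`. -/
theorem aeval_hsymm_option {σ : Type*} [Fintype σ] [DecidableEq σ] (y : Option σ → K) (n : ℕ) :
    aeval y (hsymm (Option σ) K (n + 1)) =
      y none * aeval y (hsymm (Option σ) K n) +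
        aeval (fun a => y (some a)) (hsymm σ K (n + 1)) := by
  have h : ∀ (τ : Type _) [Fintype τ] [DecidableEq τ] (z : τ → K) (n : ℕ),
      aeval z (hsymm τ K n) = ∑ s : Sym τ n, (s.1.map z).prod := by
    intro τ _ _ z n
    simp only [hsymm, map_sum, map_multiset_prod, Multiset.map_map, Function.comp_def, aeval_X]
  rw [h, h, h, ← Equiv.sum_comp symOptionSuccEquiv.symm, Fintype.sum_sum_type, Finset.mul_sum]
  congr 1
  · refine Finset.sum_congr rfl fun s _ => ?_
    change ((none ::ₛ s : Sym (Option σ) (n + 1)).1.map y).prod = _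
    rw [Sym.val_eq_coe, Sym.coe_cons, Multiset.map_cons, Multiset.prod_cons]
    rfl
  · refine Finset.sum_congr rfl fun s _ => ?_
    change ((s.map Function.Embedding.some).1.map y).prod = _
    rw [Sym.val_eq_coe, Sym.coe_map, Multiset.map_map]
    rfl

variable {N : ℕ}

/-- The complete homogeneous symmetric function `h_n` of the variables `x_a`, `a ∈ A`. -/
def hSet (x : Fin N → K) (A : Finset (Fin N)) (n : ℕ) : K :=
  aeval (fun a : A => x a) (hsymm A K n)

theorem hSet_zero (x : Fin N → K) (A : Finset (Fin N)) : hSet x A 0 = 1 := by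
  simp [hSet]

theorem hSet_empty (x : Fin N → K) (n : ℕ) : hSet x ∅ (n + 1) = 0 := by
  have : IsEmpty (Sym (∅ : Finset (Fin N)) (n + 1)) := inferInstance
  simp [hSet, hsymm]

theorem hSet_insert (x : Fin N → K) {p : Fin N} {B : Finset (Fin N)} (hp : p ∉ B) (n : ℕ) :
    hSet x (insert p B) (n + 1) = x p * hSet x (insert p B) n + hSet x B (n + 1) := by
  have key : ∀ n, hSet x (insert p B) n =
      aeval (fun o : Option B => o.elim (x p) fun b => x b) (hsymm (Option B) K n) := by
    intro n
    rw [hSet, ← rename_hsymm (σ := Option B) K n (Finset.subtypeInsertEquivOption hp).symm,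
      aeval_rename]
    congr 2
    funext o
    cases o <;> rfl
  rw [key, key, aeval_hsymm_option]
  rfl

end CompleteHomogeneous

/-! ### Sums over finite sets, sorted by largest element -/

theorem sum_powerset_eq_sum_max {α M : Type*} [LinearOrder α] [AddCommMonoid M]
    (f : Finset α → M) (s : Finset α) :
    ∑ B ∈ s.powerset, f B =
      f ∅ + ∑ q ∈ s, ∑ B ∈ (s.filter (· < q)).powerset, f (insert q B) := by
  induction s using Finset.induction_on_max with
  | empty => simp
  | insert a s ha ih =>
    have hnot : a ∉ s := fun h => lt_irrefl _ (ha a h)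
    rw [Finset.sum_powerset_insert hnot, ih, Finset.sum_insert hnot, add_assoc]
    congr 1
    rw [add_comm]
    congr 1
    · rw [Finset.filter_insert, if_neg (lt_irrefl a), Finset.filter_true_of_mem ha]
    · refine Finset.sum_congr rfl fun q hq => ?_
      rw [Finset.filter_insert, if_neg (ha q hq).not_gt]

theorem sum_powerset_Iio {N : ℕ} {M : Type*} [AddCommMonoid M] (f : Finset (Fin N) → M)
    (p : Fin N) : ∑ B ∈ (Finset.Iio p).powerset, f B =
      f ∅ + ∑ q ∈ Finset.Iio p, ∑ B ∈ (Finset.Iio q).powerset, f (insert q B) := by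
  rw [sum_powerset_eq_sum_max]
  congr 1
  refine Finset.sum_congr rfl fun q hq => ?_
  congr 2
  ext r
  simp only [Finset.mem_filter, Finset.mem_Iio, and_iff_right_iff_imp]
  exact fun h => h.trans (Finset.mem_Iio.mp hq)

theorem sum_powerset_univ {N : ℕ} {M : Type*} [AddCommMonoid M] (f : Finset (Fin N) → M) :
    ∑ B ∈ (Finset.univ : Finset (Fin N)).powerset, f B =
      f ∅ + ∑ q, ∑ B ∈ (Finset.Iio q).powerset, f (insert q B) := by
  rw [sum_powerset_eq_sum_max]
  congr 1
  refine Finset.sum_congr rfl fun q hq => ?_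
  congr 2
  ext r
  simp

/-! ### Powers of the leading operators on a regular orbit -/

section Orbit

variable {K : Type*} [Field K] {N : ℕ}

/-- The cycle which runs through the elements of `A` in decreasing order. -/
def descCycle (A : Finset (Fin N)) : Equiv.Perm (Fin N) := (A.sort (· ≥ ·)).formPerm

theorem descCycle_singleton (p : Fin N) : descCycle {p} = 1 := by
  simp [descCycle]

/-- The transposition of a jump from `p` to the next vertex `q` is exactly the factor by which the
decreasing cycle grows. -/
theorem descCycle_insert {p q : Fin N} (hqp : q < p) {B : Finset (Fin N)}
    (hB : B ⊆ Finset.Iio q) :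
    descCycle (insert p (insert q B)) = Equiv.swap p q * descCycle (insert q B) := by
  have hq : ∀ b ∈ B, b < q := fun b hb => Finset.mem_Iio.mp (hB hb)
  have hp : ∀ b ∈ insert q B, b < p := fun b hb => by
    rcases Finset.mem_insert.mp hb with rfl | hb
    · exact hqp
    · exact (hq b hb).trans hqp
  have h1 := Finset.sort_insert (· ≥ ·) (fun b hb => (hq b hb).le) fun h => lt_irrefl _ (hq q h)
  have h2 := Finset.sort_insert (· ≥ ·) (fun b hb => (hp b hb).le) fun h => lt_irrefl _ (hp p h)
  rw [descCycle, descCycle, h2, h1, List.formPerm_cons_cons]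

/-- The monomial `x^(g λ)`. -/
def orbitMonomial (K : Type*) [Field K] (la : Part N) (g : Equiv.Perm (Fin N)) :
    MvPolynomial (Fin N) K :=
  monomial ((Finsupp.equivFunOnFinite.symm la.1).mapDomain g) 1

theorem rename_orbitMonomial (la : Part N) (g h : Equiv.Perm (Fin N)) :
    rename g (orbitMonomial K la h) = orbitMonomial K la (g * h) := by
  rw [orbitMonomial, rename_monomial, ← Finsupp.mapDomain_comp]
  rfl

theorem swapTerm_orbit {la : Part N} (hla : StrictAnti la.1) (g : Equiv.Perm (Fin N))
    (p q : Fin N) :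
    swapTerm K ((Finsupp.equivFunOnFinite.symm la.1).mapDomain g) (g p) (g q) =
      if p < q then orbitMonomial K la g
      else if q < p then - orbitMonomial K la (g * Equiv.swap p q) else 0 := by
  have h : g * Equiv.swap p q = Equiv.swap (g p) (g q) * g := by
    rw [Equiv.swap_apply_apply]
    simp
  rw [swapTerm, Finsupp.mapDomain_equiv_apply, Finsupp.mapDomain_equiv_apply,
    Equiv.symm_apply_apply, Equiv.symm_apply_apply, h, ← rename_orbitMonomial, orbitMonomial,
    rename_monomial]
  simp only [Finsupp.equivFunOnFinite_symm_apply_apply, hla.lt_iff_gt]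

variable (θ : K)

/-- The exponent of `x^(gλ)` at `g p` is `λ_p`, so comparing exponents at `g p` and `g q` is
comparing `p` and `q`. Each `q > p` contributes a copy of `x^(gλ)`, which shifts `λ_p` to `ℓ_p`;
each `q < p` contributes a transposed monomial. -/
theorem leadOp_orbitMonomial {la : Part N} (hla : StrictAnti la.1) (g : Equiv.Perm (Fin N))
    (p : Fin N) :
    leadOp θ (g p) (orbitMonomial K la g) = shifted θ la p • orbitMonomial K la g -
      θ • ∑ q ∈ Finset.Iio p, orbitMonomial K la (g * Equiv.swap p q) := by
  have hsum : ∑ j ∈ Finset.univ.erase (g p),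
      swapTerm K ((Finsupp.equivFunOnFinite.symm la.1).mapDomain g) (g p) j =
      ((Finset.Ioi p).card : K) • orbitMonomial K la g -
        ∑ q ∈ Finset.Iio p, orbitMonomial K la (g * Equiv.swap p q) := by
    have h1 : ∑ j ∈ Finset.univ.erase (g p),
        swapTerm K ((Finsupp.equivFunOnFinite.symm la.1).mapDomain g) (g p) j =
        ∑ q ∈ Finset.univ.erase p,
          swapTerm K ((Finsupp.equivFunOnFinite.symm la.1).mapDomain g) (g p) (g q) :=
      (Finset.sum_equiv g (by simp) (by simp)).symm
    have h2 : Finset.univ.erase p = Finset.Ioi p ∪ Finset.Iio p := by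
      ext q
      simp only [Finset.mem_erase, Finset.mem_univ, and_true, Finset.mem_union, Finset.mem_Ioi,
        Finset.mem_Iio]
      exact ne_iff_lt_or_gt.trans or_comm
    have h3 : Disjoint (Finset.Ioi p) (Finset.Iio p) :=
      Finset.disjoint_left.mpr fun q hq hq' =>
        lt_asymm (Finset.mem_Ioi.mp hq) (Finset.mem_Iio.mp hq')
    rw [h1, h2, Finset.sum_union h3, sub_eq_add_neg, ← Finset.sum_neg_distrib,
      Nat.cast_smul_eq_nsmul, ← Finset.sum_const]
    congr 1
    · refine Finset.sum_congr rfl fun q hq => ?_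
      rw [swapTerm_orbit hla, if_pos (Finset.mem_Ioi.mp hq)]
    · refine Finset.sum_congr rfl fun q hq => ?_
      have hq := Finset.mem_Iio.mp hq
      rw [swapTerm_orbit hla, if_neg hq.not_gt, if_pos hq]
  have hcard : ((Finset.Ioi p).card : K) = (N : K) - ((p : ℕ) + 1 : K) := by
    rw [Fin.card_Ioi, Nat.sub_sub, Nat.cast_sub (by have := p.2; omega)]
    push_cast
    ring
  conv_lhs => rw [orbitMonomial, leadOp_monomial, hsum]
  rw [hcard, Finsupp.mapDomain_equiv_apply, Equiv.symm_apply_apply, shifted, smul_sub, smul_smul,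
    add_smul, Finsupp.equivFunOnFinite_symm_apply_apply]
  rw [orbitMonomial]
  abel

/-- The weight of the paths with vertices `{p} ∪ B` in the `m`-th power of a leading operator. -/
def pathWeight (x : Fin N → K) (m : ℕ) (A : Finset (Fin N)) : K :=
  if A.card ≤ m + 1 then (-θ) ^ (A.card - 1) * hSet x A (m + 1 - A.card) else 0

/-- The first step stays at `p` or leaves it for good: this is the recursion of complete homogeneous
functions. When every step must be a jump (`b = m`), only the second term remains; there the guard
in `pathWeight` matters, since truncated subtraction would give `h_0 = 1` instead of `0` for the
first. -/
theorem pathWeight_succ (x : Fin N → K) (m : ℕ) {p : Fin N} {B : Finset (Fin N)} (hp : p ∉ B)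
    (hB : B.Nonempty) :
    pathWeight θ x (m + 1) (insert p B) =
      x p * pathWeight θ x m (insert p B) - θ * pathWeight θ x m B := by
  have hb : 0 < B.card := hB.card_pos
  obtain ⟨b, hb⟩ : ∃ b, B.card = b + 1 := ⟨B.card - 1, by omega⟩
  simp only [pathWeight, Finset.card_insert_of_notMem hp, hb]
  rcases lt_trichotomy b m with h | h | h
  · obtain ⟨d, rfl⟩ := Nat.exists_eq_add_of_lt h
    rw [if_pos (by omega), if_pos (by omega), if_pos (by omega),
      show b + d + 1 + 1 + 1 - (b + 1 + 1) = d + 1 by omega,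
      show b + d + 1 + 1 - (b + 1 + 1) = d by omega,
      show b + d + 1 + 1 - (b + 1) = d + 1 by omega, hSet_insert x hp]
    simp only [add_tsub_cancel_right]
    ring
  · subst h
    rw [if_pos (by omega), if_neg (by omega), if_pos (by omega)]
    simp only [tsub_self, hSet_zero, add_tsub_cancel_right]
    ring
  · rw [if_neg (by omega), if_neg (by omega), if_neg (by omega)]
    ring

theorem pathWeight_singleton_succ (x : Fin N → K) (m : ℕ) (p : Fin N) :
    pathWeight θ x (m + 1) {p} = x p * pathWeight θ x m {p} := by
  have h := hSet_insert x (Finset.notMem_empty p) m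
  rw [hSet_empty, add_zero, LawfulSingleton.insert_empty_eq] at h
  simp [pathWeight, h]

theorem pathWeight_zero (x : Fin N → K) {p : Fin N} {B : Finset (Fin N)} (hp : p ∉ B)
    (hB : B ≠ ∅) : pathWeight θ x 0 (insert p B) = 0 := by
  have := (Finset.nonempty_iff_ne_empty.mpr hB).card_pos
  rw [pathWeight, if_neg]
  rw [Finset.card_insert_of_notMem hp]
  omega

/-- Expansion over descending walks from `p`, grouped by the set `B` of later vertices. Peeling off
the first step matches the splitting of subsets of `Iio p` by their largest element `q`. -/
theorem leadOp_pow_orbitMonomial {la : Part N} (hla : StrictAnti la.1) (m : ℕ)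
    (g : Equiv.Perm (Fin N)) (p : Fin N) :
    (leadOp θ (g p) ^ m) (orbitMonomial K la g) =
      ∑ B ∈ (Finset.Iio p).powerset, pathWeight θ (shifted θ la) m (insert p B) •
        orbitMonomial K la (g * descCycle (insert p B)) := by
  have hnot : ∀ {q : Fin N} {B : Finset (Fin N)}, B ⊆ Finset.Iio q → q ∉ B := fun hB h =>
    lt_irrefl _ (Finset.mem_Iio.mp (hB h))
  induction m generalizing g p with
  | zero =>
    rw [Finset.sum_eq_single ∅]
    · simp [pathWeight, hSet_zero, descCycle_singleton]
    · intro B hB hne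
      rw [pathWeight_zero θ _ (hnot (Finset.mem_powerset.mp hB)) hne, zero_smul]
    · intro h
      exact absurd (Finset.empty_mem_powerset _) h
  | succ m ih =>
    -- As `g p = (g * swap p q) q`, the same operator now sits at index `q`.
    have hstep : ∀ q, (leadOp θ (g p) ^ m) (orbitMonomial K la (g * Equiv.swap p q)) =
        ∑ B ∈ (Finset.Iio q).powerset, pathWeight θ (shifted θ la) m (insert q B) •
          orbitMonomial K la (g * Equiv.swap p q * descCycle (insert q B)) := by
      intro q
      have := ih (g * Equiv.swap p q) q
      rwa [Equiv.Perm.mul_apply, Equiv.swap_apply_right] at this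
    rw [pow_succ, Module.End.mul_apply, leadOp_orbitMonomial θ hla, map_sub, map_smul, map_smul,
      map_sum, ih, sum_powerset_Iio, sum_powerset_Iio, Finset.sum_congr rfl fun q _ => hstep q,
      LawfulSingleton.insert_empty_eq, pathWeight_singleton_succ, smul_add, Finset.smul_sum,
      Finset.smul_sum, smul_smul, add_sub_assoc, ← Finset.sum_sub_distrib]
    congr 1
    refine Finset.sum_congr rfl fun q hq => ?_
    rw [Finset.smul_sum, Finset.smul_sum, ← Finset.sum_sub_distrib]
    refine Finset.sum_congr rfl fun B hB => ?_
    have hqp := Finset.mem_Iio.mp hq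
    have hB := Finset.mem_powerset.mp hB
    have hpB : p ∉ insert q B := by
      rw [Finset.mem_insert, not_or]
      exact ⟨hqp.ne', fun h => lt_asymm hqp (Finset.mem_Iio.mp (hB h))⟩
    rw [pathWeight_succ θ _ m hpB (Finset.insert_nonempty q B), descCycle_insert hqp hB, mul_assoc,
      sub_smul, smul_smul, smul_smul]

/-- Summing over `i = g p` makes the coefficients independent of `g`: the operator is right
multiplication by a fixed element of the group algebra. -/
theorem leadHp_orbitMonomial {la : Part N} (hla : StrictAnti la.1) (m : ℕ)
    (g : Equiv.Perm (Fin N)) :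
    leadHp θ m (orbitMonomial K la g) =
      ∑ p, ∑ B ∈ (Finset.Iio p).powerset, pathWeight θ (shifted θ la) m (insert p B) •
        orbitMonomial K la (g * descCycle (insert p B)) := by
  rw [leadHp, LinearMap.sum_apply, ← Equiv.sum_comp g]
  exact Finset.sum_congr rfl fun p _ => leadOp_pow_orbitMonomial θ hla m g p

theorem isConj_formPerm {l l' : List (Fin N)} (hl : l.Nodup) (hl' : l'.Nodup)
    (h : l.length = l'.length) : IsConj l.formPerm l'.formPerm := by
  rcases lt_or_ge l.length 2 with h2 | h2
  · rw [(List.formPerm_eq_one_iff l hl).mpr (by omega),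
      (List.formPerm_eq_one_iff l' hl').mpr (by omega)]
  · have hne : ∀ {l : List (Fin N)}, 2 ≤ l.length → ∀ x, l ≠ [x] := by
      rintro _ h x rfl
      simp at h
    refine (List.isCycle_formPerm hl h2).isConj (List.isCycle_formPerm hl' (h ▸ h2)) ?_
    rw [List.support_formPerm_of_nodup l hl (hne h2),
      List.support_formPerm_of_nodup l' hl' (hne (h ▸ h2)), List.toFinset_card_of_nodup hl,
      List.toFinset_card_of_nodup hl', h]

theorem isConj_descCycle_firstCycle (A : Finset (Fin N)) :
    IsConj (descCycle A) (firstCycle N A.card) := by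
  refine isConj_formPerm (Finset.sort_nodup _ _) ((List.nodup_finRange N).sublist
    (List.take_sublist _ _)) ?_
  have : A.card ≤ N := (Finset.card_le_univ A).trans (by simp)
  rw [Finset.length_sort, List.length_take, List.length_finRange, min_eq_left this]

/-- Pairs `(p, B)` enumerate the nonempty sets by maximum and rest; grouping them by size leaves one
conjugacy class of cycles for each `k`. -/
theorem sum_pathWeight {la : Part N} (m : ℕ) (χ : Equiv.Perm (Fin N) → K)
    (hχ : ∀ g h, IsConj g h → χ g = χ h) :
    ∑ p, ∑ B ∈ (Finset.Iio p).powerset, pathWeight θ (shifted θ la) m (insert p B) *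
        χ (descCycle (insert p B)) =
      ∑ k ∈ Finset.Icc 1 (min (m + 1) N), (-θ) ^ (k - 1) *
        hSub k (m + 1 - k) (shifted θ la) * χ (firstCycle N k) := by
  -- The value `0` at the empty set permits summation over all subsets.
  set f : Finset (Fin N) → K := fun A => if A.Nonempty then
    pathWeight θ (shifted θ la) m A * χ (descCycle A) else 0 with hf
  have h1 : ∑ p, ∑ B ∈ (Finset.Iio p).powerset, pathWeight θ (shifted θ la) m (insert p B) *
      χ (descCycle (insert p B)) = ∑ A ∈ (Finset.univ : Finset (Fin N)).powerset, f A := by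
    rw [sum_powerset_univ]
    simp [hf]
  have h2 : ∀ k, k ∈ Finset.Icc 1 (min (m + 1) N) →
      ∑ A ∈ Finset.powersetCard k Finset.univ, f A = (-θ) ^ (k - 1) *
        hSub k (m + 1 - k) (shifted θ la) * χ (firstCycle N k) := by
    intro k hk
    obtain ⟨hk1, hk2⟩ := Finset.mem_Icc.mp hk
    rw [hSub, Finset.mul_sum, Finset.sum_mul]
    refine Finset.sum_congr rfl fun A hA => ?_
    have hA := (Finset.mem_powersetCard.mp hA).2
    have hne : A.Nonempty := Finset.card_pos.mp (by omega)
    rw [hf]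
    simp only [if_pos hne, pathWeight, hχ _ _ (isConj_descCycle_firstCycle A), hA, hSet]
    rw [if_pos (hk2.trans (min_le_left _ _))]
  rw [h1, Finset.sum_powerset, ← Finset.sum_congr rfl h2]
  symm
  apply Finset.sum_subset
  · intro k hk
    obtain ⟨hk1, hk2⟩ := Finset.mem_Icc.mp hk
    have := min_le_right (m + 1) N
    simp only [Finset.card_univ, Fintype.card_fin, Finset.mem_range]
    omega
  -- Excluded sizes are `0`, where `f` vanishes, and those above `m + 1`, where the weight vanishes.
  · intro k hk hk'
    refine Finset.sum_eq_zero fun A hA => ?_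
    have hA := (Finset.mem_powersetCard.mp hA).2
    simp only [Finset.card_univ, Fintype.card_fin, Finset.mem_range] at hk
    rw [hf]
    simp only [ite_eq_right_iff]
    intro hne
    have hpos := hne.card_pos
    have : ¬ A.card ≤ m + 1 := fun h => hk' (Finset.mem_Icc.mpr ⟨by omega, le_min (by omega)
      (by omega)⟩)
    rw [pathWeight, if_neg this, zero_mul]

end Orbit

/-! ### Isotypical components -/

section Isotypic

variable {K : Type*} [Field K] {N : ℕ}

theorem IrrepClass.char_eq (τ : IrrepClass K N) : τ.char = τ.rep.character := rfl

instance IrrepClass.irreducible (τ : IrrepClass K N) : τ.rep.IsIrreducible :=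
  (Quotient.out τ).irreducible

theorem IrrepClass.nonempty_equiv_iff {σ τ : IrrepClass K N} :
    Nonempty (σ.rep.Equiv τ.rep) ↔ σ = τ := by
  constructor
  · intro h
    rw [← Quotient.out_eq σ, ← Quotient.out_eq τ]
    exact Quotient.sound h
  · rintro rfl
    exact ⟨Representation.Equiv.refl _⟩

theorem IrrepClass.dim_pos (τ : IrrepClass K N) : 0 < τ.dim := by
  by_contra h
  have h0 : (Quotient.out τ).dim = 0 := Nat.eq_zero_of_not_pos h
  have hsub : Subsingleton (Fin (Quotient.out τ).dim → K) := by
    rw [h0]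
    infer_instance
  obtain ⟨U, W, hne⟩ := (IrrepClass.irreducible τ).exists_pair_ne
  refine hne (Subrepresentation.toSubmodule_injective ?_)
  exact Subsingleton.elim _ _

theorem IrrepClass.char_conj (τ : IrrepClass K N) {g h : Equiv.Perm (Fin N)} (hgh : IsConj g h) :
    τ.char g = τ.char h := by
  obtain ⟨c, rfl⟩ := isConj_iff.mp hgh
  exact (Representation.char_conj τ.rep g c).symm

/-- The element `(dim τ / N!) ∑_g χ^τ(g⁻¹) g` of the group algebra in a representation. -/
def isotypicSum {M : Type*} [AddCommGroup M] [Module K M] (τ : IrrepClass K N)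
    (ρ : Representation K (Equiv.Perm (Fin N)) M) : Module.End K M :=
  ((τ.dim : K) / (Nat.card (Equiv.Perm (Fin N)) : K)) •
    ∑ g : Equiv.Perm (Fin N), τ.char g⁻¹ • ρ g

theorem isotypicSum_apply {M : Type*} [AddCommGroup M] [Module K M] (τ : IrrepClass K N)
    (ρ : Representation K (Equiv.Perm (Fin N)) M) (v : M) :
    isotypicSum τ ρ v = ((τ.dim : K) / (Nat.card (Equiv.Perm (Fin N)) : K)) •
      ∑ g : Equiv.Perm (Fin N), τ.char g⁻¹ • ρ g v := by
  simp [isotypicSum, LinearMap.sum_apply]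

/-- Characters are class functions, so this group algebra element is central. -/
theorem isotypicSum_comm {M : Type*} [AddCommGroup M] [Module K M] (τ : IrrepClass K N)
    (ρ : Representation K (Equiv.Perm (Fin N)) M) (h : Equiv.Perm (Fin N)) :
    isotypicSum τ ρ * ρ h = ρ h * isotypicSum τ ρ := by
  rw [isotypicSum, smul_mul_assoc, mul_smul_comm, Finset.sum_mul, Finset.mul_sum]
  congr 1
  refine Finset.sum_equiv (MulAut.conj h⁻¹).toEquiv (by simp) fun g _ => ?_
  have hc : (MulAut.conj h⁻¹).toEquiv g = h⁻¹ * g * h := by simp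
  rw [hc, smul_mul_assoc, mul_smul_comm, ← map_mul, ← map_mul]
  congr 1
  · refine τ.char_conj (isConj_iff.mpr ⟨h⁻¹, ?_⟩)
    group
  · congr 1
    group

theorem isotypic_le_V (la : Part N) (τ : IrrepClass K N) : isotypic la τ ≤ V K la :=
  sSup_le fun _ ⟨_, _, hW, _⟩ => hW

theorem le_isotypic {la : Part N} {τ : IrrepClass K N} {U : Subrepresentation (polyRep K N)}
    (hU : U.toSubmodule ≤ V K la) (h : Nonempty (U.toRepresentation.Equiv τ.rep)) :
    U.toSubmodule ≤ isotypic la τ :=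
  le_sSup ⟨U, rfl, hU, h⟩

theorem isotypicSum_mem_V (τ : IrrepClass K N) {la : Part N} {f : MvPolynomial (Fin N) K}
    (hf : f ∈ V K la) : isotypicSum τ (polyRep K N) f ∈ V K la := by
  rw [isotypicSum_apply]
  exact Submodule.smul_mem _ _ (Submodule.sum_mem _ fun g _ =>
    Submodule.smul_mem _ _ (rename_mem_V g hf))

variable [CharZero K]

theorem card_perm_ne_zero : (Nat.card (Equiv.Perm (Fin N)) : K) ≠ 0 :=
  Nat.cast_ne_zero.mpr Nat.card_pos.ne'

variable [IsAlgClosed K]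

open Classical in
-- By Schur's lemma the central element acts on an irreducible representation by a scalar; its
-- trace, computed by orthogonality of characters, determines that scalar.
theorem isotypicSum_rep (τ σ : IrrepClass K N) :
    isotypicSum τ σ.rep = if σ = τ then 1 else 0 := by
  let E : Representation.IntertwiningMap σ.rep σ.rep :=
    ⟨isotypicSum τ σ.rep, fun g => isotypicSum_comm τ σ.rep g⟩
  obtain ⟨c, hc⟩ :=
    (Representation.IsIrreducible.algebraMap_intertwiningMap_bijective_of_isAlgClosed
      (ρ := σ.rep)).2 E
  have hE : isotypicSum τ σ.rep = c • (1 : Module.End K _) := by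
    have : isotypicSum τ σ.rep = E.toLinearMap := rfl
    rw [this, ← hc]
    rfl
  have hcard := card_perm_ne_zero (K := K) (N := N)
  have : Invertible (Nat.card (Equiv.Perm (Fin N)) : K) := invertibleOfNonzero hcard
  have hdim : (σ.dim : K) ≠ 0 := Nat.cast_ne_zero.mpr σ.dim_pos.ne'
  have htr : LinearMap.trace K _ (isotypicSum τ σ.rep) = c * σ.dim := by
    rw [hE, map_smul, LinearMap.trace_one, Module.finrank_fin_fun, smul_eq_mul]
    rfl
  have horth := Representation.char_orthonormal σ.rep τ.rep
  have htr' : LinearMap.trace K _ (isotypicSum τ σ.rep) =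
      τ.dim * ((Nat.card (Equiv.Perm (Fin N)) : K)⁻¹ *
        ∑ g, σ.rep.character g * τ.rep.character g⁻¹) := by
    rw [isotypicSum, map_smul, map_sum, smul_eq_mul, div_eq_mul_inv, mul_assoc]
    simp only [map_smul, smul_eq_mul, IrrepClass.char_eq, Representation.character, mul_comm]
  rw [horth, htr, IrrepClass.nonempty_equiv_iff] at htr'
  rw [hE]
  split_ifs with h
  · subst h
    rw [if_pos rfl, mul_one] at htr'
    rw [mul_right_cancel₀ hdim (htr'.trans (one_mul _).symm), one_smul]
  · rw [if_neg (Ne.symm h), mul_zero] at htr'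
    rw [(mul_eq_zero.mp htr').resolve_right hdim, zero_smul]

open Classical in
-- It suffices to look at one invariant subspace isomorphic to `σ`, where the action is transported
-- from `isotypicSum_rep`.
theorem isotypicSum_of_mem_isotypic (τ : IrrepClass K N) {σ : IrrepClass K N} {la : Part N}
    {f : MvPolynomial (Fin N) K} (hf : f ∈ isotypic la σ) :
    isotypicSum τ (polyRep K N) f = if σ = τ then f else 0 := by
  suffices isotypic la σ ≤ LinearMap.eqLocus (isotypicSum τ (polyRep K N))
      (if σ = τ then 1 else 0) by
    have := this hf
    rw [LinearMap.mem_eqLocus] at this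
    rw [this]
    split_ifs <;> rfl
  refine sSup_le ?_
  rintro W ⟨U, rfl, -, ⟨φ⟩⟩ u hu
  rw [LinearMap.mem_eqLocus]
  let u' : U.toSubmodule := ⟨u, hu⟩
  have h1 : φ.toLinearEquiv (isotypicSum τ U.toRepresentation u') =
      isotypicSum τ σ.rep (φ.toLinearEquiv u') := by
    rw [isotypicSum_apply, isotypicSum_apply, map_smul, map_sum]
    congr 1
    refine Finset.sum_congr rfl fun g _ => ?_
    rw [map_smul]
    congr 1
    exact Representation.IntertwiningMap.isIntertwining _ _ φ.toIntertwiningMap g u'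
  have h2 : isotypicSum τ (polyRep K N) u =
      (isotypicSum τ U.toRepresentation u' : U.toSubmodule) := by
    rw [isotypicSum_apply, isotypicSum_apply, Submodule.coe_smul, Submodule.coe_sum]
    rfl
  rw [isotypicSum_rep] at h1
  rw [h2]
  split_ifs at h1 ⊢ with h
  · rw [Module.End.one_apply, EmbeddingLike.apply_eq_iff_eq] at h1
    rw [h1]
    rfl
  · rw [LinearMap.zero_apply, EmbeddingLike.map_eq_zero_iff] at h1
    rw [h1]
    rfl

end Isotypic

/-! ### Finite-dimensionality and complete reducibility of `V_λ` -/

instance V_finiteDimensional {K : Type*} [Field K] {N : ℕ} (la : Part N) :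
    FiniteDimensional K (V K la) := by
  apply FiniteDimensional.span_of_finite
  have hfin : {γ : Fin N →₀ ℕ | sortDesc γ = la}.Finite := by
    refine Set.Finite.subset (Set.finite_range fun g : Equiv.Perm (Fin N) =>
      (Finsupp.equivFunOnFinite.symm la.1).mapDomain g) ?_
    rintro γ rfl
    exact ⟨sortPerm γ, mapDomain_sortPerm γ⟩
  refine (hfin.image fun γ => monomial γ (1 : K)).subset ?_
  rintro _ ⟨γ, hγ, rfl⟩
  exact ⟨γ, hγ, rfl⟩

instance isotypic_finiteDimensional {K : Type*} [Field K] {N : ℕ} (la : Part N)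
    (τ : IrrepClass K N) : FiniteDimensional K (isotypic la τ) :=
  Submodule.finiteDimensional_of_le (S₂ := V K la) (sSup_le fun _ ⟨_, _, hW, _⟩ => hW)

section Semisimple

variable {K : Type*} [Field K] {N : ℕ}

/-- A minimal invariant subspace is isomorphic to some irreducible representation. -/
theorem exists_irrepClass_equiv {M : Type*} [AddCommGroup M] [Module K M]
    {ρ : Representation K (Equiv.Perm (Fin N)) M} {A : Subrepresentation ρ} (hA : IsAtom A)
    [FiniteDimensional K A.toSubmodule] :
    ∃ τ : IrrepClass K N, Nonempty (A.toRepresentation.Equiv τ.rep) := by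
  let ψ : A.toSubmodule ≃ₗ[K] (Fin (Module.finrank K A.toSubmodule) → K) :=
    (Module.finBasis K A.toSubmodule).equivFun
  let r : Representation K (Equiv.Perm (Fin N)) (Fin (Module.finrank K A.toSubmodule) → K) :=
    { toFun := fun g => ψ.toLinearMap ∘ₗ A.toRepresentation g ∘ₗ ψ.symm.toLinearMap
      map_one' := by
        refine LinearMap.ext fun x => ?_
        simp
      map_mul' := fun g h => by
        refine LinearMap.ext fun x => ?_
        simp }
  have hr : ∀ g x, r g (ψ x) = ψ (A.toRepresentation g x) := fun g x => by
    change ψ (A.toRepresentation g (ψ.symm (ψ x))) = _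
    rw [ψ.symm_apply_apply]
  have hirr : r.IsIrreducible := by
    have hnt : (⊥ : Subrepresentation r) ≠ ⊤ := by
      intro h
      refine hA.1 (le_antisymm (fun x hx => ?_) bot_le)
      have h1 : ψ ⟨x, hx⟩ ∈ (⊥ : Subrepresentation r).toSubmodule := by
        rw [h]
        exact Submodule.mem_top (R := K)
      have h2 : ψ ⟨x, hx⟩ = 0 := (Submodule.mem_bot K).mp h1
      rw [EmbeddingLike.map_eq_zero_iff] at h2
      exact (Submodule.mem_bot K).mpr (congrArg Subtype.val h2)
    have : Nontrivial (Subrepresentation r) := ⟨⟨_, _, hnt⟩⟩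
    refine ⟨fun S => ?_⟩
    -- Minimality of `A` applies to subrepresentations of `ρ`, so `S` is pulled back along the
    -- coordinates into `A`.
    let S' : Subrepresentation ρ :=
      { toSubmodule := (S.toSubmodule.comap ψ.toLinearMap).map A.toSubmodule.subtype
        apply_mem_toSubmodule := by
          rintro g _ ⟨x, hx, rfl⟩
          refine ⟨A.toRepresentation g x, ?_, rfl⟩
          change ψ (A.toRepresentation g x) ∈ S.toSubmodule
          rw [← hr]
          exact S.apply_mem_toSubmodule g hx }
    have hS' : ∀ x : A.toSubmodule, (x : M) ∈ S'.toSubmodule ↔ ψ x ∈ S.toSubmodule := by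
      intro x
      constructor
      · rintro ⟨y, hy, hxy⟩
        rwa [← Subtype.ext hxy]
      · intro h
        exact ⟨x, h, rfl⟩
    have hle : S' ≤ A := by
      rintro _ ⟨x, -, rfl⟩
      exact x.2
    rcases hA.le_iff.mp hle with h | h
    · left
      refine le_antisymm (fun y hy => ?_) bot_le
      have h1 : ((ψ.symm y : A.toSubmodule) : M) ∈ S'.toSubmodule := by
        rw [hS', ψ.apply_symm_apply]
        exact hy
      rw [h] at h1
      have h2 : ψ.symm y = 0 := Subtype.ext ((Submodule.mem_bot K).mp h1)
      rw [EmbeddingLike.map_eq_zero_iff] at h2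
      exact (Submodule.mem_bot K).mpr h2
    · right
      refine le_antisymm le_top fun y _ => ?_
      have h1 : ((ψ.symm y : A.toSubmodule) : M) ∈ S'.toSubmodule := by
        rw [h]
        exact (ψ.symm y).2
      rwa [hS', ψ.apply_symm_apply] at h1
  let σ : Irrep K N := ⟨_, r, hirr⟩
  have e1 : A.toRepresentation.Equiv r := Representation.Equiv.mk ψ fun g =>
    LinearMap.ext fun x => (hr g x).symm
  -- The chosen representative of the class is only isomorphic to `σ`.
  obtain ⟨e2⟩ : Nonempty (r.Equiv (Quotient.out (⟦σ⟧ : IrrepClass K N)).rep) :=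
    Setoid.symm (Quotient.mk_out σ)
  exact ⟨⟦σ⟧, ⟨e1.trans e2⟩⟩

variable [CharZero K]

/-- Maschke's theorem: `V_λ` is the sum of its minimal invariant subspaces, each of which lies in
some isotypical component. -/
theorem V_le_iSup_isotypic (la : Part N) : V K la ≤ ⨆ τ : IrrepClass K N, isotypic la τ := by
  have : NeZero (Nat.card (Equiv.Perm (Fin N)) : K) := ⟨Nat.cast_ne_zero.mpr Nat.card_pos.ne'⟩
  have hss : IsSemisimpleModule (MonoidAlgebra K (Equiv.Perm (Fin N))) (polyRep K N).asModule :=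
    (Representation.isSemisimpleRepresentation_iff_isSemisimpleModule_asModule _).mp inferInstance
  let Vr : Subrepresentation (polyRep K N) := ⟨V K la, fun g f hf => rename_mem_V g hf⟩
  let T : Subrepresentation (polyRep K N) :=
    ⟨⨆ τ : IrrepClass K N, isotypic la τ, fun g f hf => by
      suffices (⨆ τ : IrrepClass K N, isotypic la τ) ≤
        (⨆ τ : IrrepClass K N, isotypic la τ).comap (polyRep K N g) from this hf
      refine iSup_le fun τ => sSup_le ?_
      rintro W ⟨U, rfl, hW, hU⟩ u hu
      exact le_iSup (fun τ : IrrepClass K N => isotypic la τ) τ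
        (le_isotypic hW hU (U.apply_mem_toSubmodule g hu))⟩
  let e := Subrepresentation.subrepresentationSubmoduleOrderIso (ρ := polyRep K N)
  suffices h : e Vr ≤ e T from e.le_iff_le.mp h
  rw [← sSup_atoms_le_eq (e Vr)]
  refine sSup_le ?_
  rintro B ⟨hB, hBV⟩
  obtain ⟨A, rfl⟩ := e.surjective B
  have hA : IsAtom A := (e.isAtom_iff A).mp hB
  have hAV : A.toSubmodule ≤ V K la := e.le_iff_le.mp hBV
  have : FiniteDimensional K A.toSubmodule := Submodule.finiteDimensional_of_le hAV
  obtain ⟨τ, hτ⟩ := exists_irrepClass_equiv hA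
  refine e.le_iff_le.mpr ?_
  exact (le_isotypic hAV hτ).trans
    (le_iSup (fun τ : IrrepClass K N => isotypic la τ) τ)

end Semisimple

/-! ### Leading parts of a system of eigenfunctions -/

section LeadingParts

variable {K : Type*} [Field K] {N : ℕ} {θ : K} {F : Family K N}

theorem IsEigensystem.mem_domSpan (hF : IsEigensystem θ F) (la : Part N) (τ : IrrepClass K N)
    (i : Fin (Module.finrank K (isotypic la τ))) : F la τ i ∈ domSpan K la :=
  fun γ hγ => hF.dominated la τ i γ hγ

theorem IsEigensystem.lead_mem (hF : IsEigensystem θ F) (la : Part N) (τ : IrrepClass K N)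
    (i : Fin (Module.finrank K (isotypic la τ))) : lead K la (F la τ i) ∈ isotypic la τ :=
  hF.leading la τ i

variable [IsAlgClosed K] [CharZero K]

/-- Projecting a spanning set of `V_λ` to the `τ`-component kills the leading parts with other
labels. The remaining ones span `V_{λ;τ}`, and their number is its dimension. -/
theorem IsEigensystem.linearIndependent_lead (hF : IsEigensystem θ F) {la : Part N}
    (hspan : V K la ≤ Submodule.span K {f | ∃ τ i, f = lead K la (F la τ i)})
    (τ : IrrepClass K N) :
    LinearIndependent K fun i => (⟨lead K la (F la τ i), hF.lead_mem la τ i⟩ : isotypic la τ) := by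
  classical
  refine linearIndependent_of_top_le_span_of_card_eq_finrank ?_ (Fintype.card_fin _)
  rintro w -
  have h1 : (w : MvPolynomial (Fin N) K) ∈ (Submodule.span K
      {f | ∃ τ i, f = lead K la (F la τ i)}).map (isotypicSum τ (polyRep K N)) :=
    ⟨w, hspan (isotypic_le_V la τ w.2), by rw [isotypicSum_of_mem_isotypic τ w.2, if_pos rfl]⟩
  have h2 : (Submodule.span K {f | ∃ τ i, f = lead K la (F la τ i)}).map
      (isotypicSum τ (polyRep K N)) ≤ (Submodule.span K (Set.range fun i =>
        (⟨lead K la (F la τ i), hF.lead_mem la τ i⟩ : isotypic la τ))).map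
          (isotypic la τ).subtype := by
    rw [Submodule.map_span_le]
    rintro _ ⟨σ, i, rfl⟩
    rw [isotypicSum_of_mem_isotypic τ (hF.lead_mem la σ i)]
    split_ifs with h
    · subst h
      exact ⟨_, Submodule.subset_span ⟨i, rfl⟩, rfl⟩
    · exact Submodule.zero_mem _
  obtain ⟨x, hx, hxw⟩ := h2 h1
  rwa [← Subtype.ext hxw]

/-- The isotypical projections separate the contributions of different `τ`; within one `τ` the
leading parts are independent. -/
theorem IsEigensystem.eq_zero_of_lead_eq_zero (hF : IsEigensystem θ F) {la : Part N}
    (hspan : V K la ≤ Submodule.span K {f | ∃ τ i, f = lead K la (F la τ i)})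
    {f : MvPolynomial (Fin N) K} (hf : f ∈ Submodule.span K {f | ∃ τ i, f = F la τ i})
    (h0 : lead K la f = 0) : f = 0 := by
  classical
  have hsup : Submodule.span K {f | ∃ τ i, f = F la τ i} ≤
      ⨆ τ, Submodule.span K (Set.range (F la τ)) := by
    rw [Submodule.span_le]
    rintro _ ⟨τ, i, rfl⟩
    exact le_iSup (fun τ => Submodule.span K (Set.range (F la τ))) τ
      (Submodule.subset_span ⟨i, rfl⟩)
  obtain ⟨c, hc, rfl⟩ := (Submodule.mem_iSup_iff_exists_finsupp _ _).mp (hsup hf)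
  have hlead : ∀ σ, lead K la (c σ) ∈ isotypic la σ := by
    intro σ
    suffices Submodule.span K (Set.range (F la σ)) ≤ (isotypic la σ).comap (lead K la) from
      this (hc σ)
    rw [Submodule.span_le]
    rintro _ ⟨i, rfl⟩
    exact hF.lead_mem la σ i
  refine Finset.sum_eq_zero fun τ hτ => ?_
  have h1 : lead K la (c τ) = 0 := by
    have h2 := congrArg (isotypicSum τ (polyRep K N)) h0
    rw [map_zero, Finsupp.sum, map_sum, map_sum] at h2
    rw [Finset.sum_congr rfl fun σ _ => isotypicSum_of_mem_isotypic τ (hlead σ)] at h2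
    rwa [Finset.sum_ite_eq', if_pos hτ] at h2
  obtain ⟨a, ha⟩ := (Submodule.mem_span_range_iff_exists_fun K).mp (hc τ)
  have hli := Fintype.linearIndependent_iff.mp (hF.linearIndependent_lead hspan τ) a (by
    apply Subtype.ext
    rw [← ha, map_sum] at h1
    simp only [map_smul] at h1
    simpa using h1)
  rw [← ha]
  exact Finset.sum_eq_zero fun i _ => by rw [hli i, zero_smul]

/-- Induction from the top of the dominance order. Expand `v ∈ V_λ` in the spanning system, with `c
mu` the contribution of label `mu`. Contributions from labels strictly above `λ` vanish, so the
`λ`-part of `v` comes from `c la` alone. -/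
theorem IsEigensystem.V_le_span_lead (hF : IsEigensystem θ F) (la : Part N) :
    V K la ≤ Submodule.span K {f | ∃ τ i, f = lead K la (F la τ i)} := by
  induction la using Dominated.induction_up with
  | h la ih =>
  intro v hv
  have hsup : (⊤ : Submodule K (MvPolynomial (Fin N) K)) ≤
      ⨆ mu, Submodule.span K {f | ∃ τ i, f = F mu τ i} := by
    rw [← hF.span_eq_top, Submodule.span_le]
    rintro _ ⟨mu, τ, i, rfl⟩
    exact le_iSup (fun mu => Submodule.span K {f | ∃ τ i, f = F mu τ i}) mu
      (Submodule.subset_span ⟨τ, i, rfl⟩)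
  obtain ⟨c, hc, hcv⟩ := (Submodule.mem_iSup_iff_exists_finsupp _ _).mp
    (hsup (Submodule.mem_top (x := v)))
  have hdom : ∀ mu, c mu ∈ domSpan K mu := by
    intro mu
    suffices Submodule.span K {f | ∃ τ i, f = F mu τ i} ≤ domSpan K mu from this (hc mu)
    rw [Submodule.span_le]
    rintro _ ⟨τ, i, rfl⟩
    exact hF.mem_domSpan mu τ i
  -- Labels not above `nu` contribute no monomials of type `nu`.
  have hlead : ∀ nu, (∀ mu, Dominated nu mu → nu ≠ mu → c mu = 0) →
      lead K nu v = lead K nu (c nu) := by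
    intro nu hnu
    rw [← hcv, Finsupp.sum, map_sum, Finset.sum_eq_single nu]
    · intro mu _ hne
      by_cases h : Dominated nu mu
      · rw [hnu mu h hne.symm, map_zero]
      · exact lead_eq_zero_of_mem_domSpan (hdom mu) h
    · intro h
      rw [Finsupp.notMem_support_iff.mp h, map_zero]
  -- A second induction from the top: once everything above `nu` is gone, the leading part of `c nu`
  -- is the `nu`-part of `v`, which is zero.
  have hzero : ∀ nu, Dominated la nu → la ≠ nu → c nu = 0 := by
    intro nu
    induction nu using Dominated.induction_up with
    | h nu ihnu =>
    intro hnu hne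
    refine hF.eq_zero_of_lead_eq_zero (ih nu hnu hne) (hc nu) ?_
    rw [← hlead nu fun mu hmu hmu' => ihnu mu hmu hmu' (hnu.trans hmu)
      fun h => hne (hnu.antisymm (h ▸ hmu))]
    rw [V_eq_restrictSupport] at hv
    exact lead_eq_zero fun γ hγ h => hne ((hv hγ).symm.trans h)
  rw [← lead_eq_self hv, hlead la hzero]
  suffices Submodule.span K {f | ∃ τ i, f = F la τ i} ≤
    (Submodule.span K {f | ∃ τ i, f = lead K la (F la τ i)}).comap (lead K la) from this (hc la)
  rw [Submodule.span_le]
  rintro _ ⟨τ, i, rfl⟩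
  exact Submodule.subset_span ⟨τ, i, rfl⟩

/-- The leading parts of the eigenfunctions form a basis of the isotypical component. -/
def IsEigensystem.leadBasis (hF : IsEigensystem θ F) (la : Part N) (τ : IrrepClass K N) :
    Module.Basis (Fin (Module.finrank K (isotypic la τ))) K (isotypic la τ) :=
  basisOfLinearIndependentOfCardEqFinrank' _
    (hF.linearIndependent_lead (hF.V_le_span_lead la) τ) (Fintype.card_fin _)

theorem IsEigensystem.leadBasis_apply (hF : IsEigensystem θ F) (la : Part N) (τ : IrrepClass K N)
    (i : Fin (Module.finrank K (isotypic la τ))) :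
    (hF.leadBasis la τ i : MvPolynomial (Fin N) K) = lead K la (F la τ i) := by
  rw [leadBasis, coe_basisOfLinearIndependentOfCardEqFinrank']

end LeadingParts

/-! ### Traces -/

section Trace

variable {K : Type*} [Field K] {N : ℕ}

theorem trace_eq_sum_repr {ι M : Type*} [Fintype ι] [DecidableEq ι] [AddCommGroup M] [Module K M]
    (b : Module.Basis ι K M) (f : Module.End K M) :
    LinearMap.trace K M f = ∑ i, b.repr (f (b i)) i := by
  rw [LinearMap.trace_eq_matrix_trace K b, Matrix.trace]
  simp [LinearMap.toMatrix_apply]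

theorem orbitMonomial_mem_V (la : Part N) (g : Equiv.Perm (Fin N)) :
    orbitMonomial K la g ∈ V K la := by
  have h : sortDesc (Finsupp.equivFunOnFinite.symm la.1) = la := by
    apply Subtype.ext
    funext i
    -- `Tuple.sort` sorts increasingly, as does reversal of an antitone tuple, and the sorted tuple
    -- is unique.
    have h1 : Monotone (la.1 ∘ Fin.revPerm) := fun i j hij => la.2 (Fin.rev_le_rev.mpr hij)
    have h2 := congrFun (Tuple.comp_sort_eq_comp_iff_monotone.mpr h1) (Fin.rev i)
    change la.1 (Tuple.sort la.1 (Fin.rev i)) = la.1 i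
    rw [← Function.comp_apply (f := la.1) (g := Tuple.sort la.1), ← h2]
    simp
  refine Submodule.subset_span ⟨_, ?_, rfl⟩
  rw [sortDesc_mapDomain, h]

theorem V_le {la : Part N} {W : Submodule K (MvPolynomial (Fin N) K)}
    (h : ∀ γ, sortDesc γ = la → monomial γ (1 : K) ∈ W) : V K la ≤ W := by
  rw [V, Submodule.span_le]
  rintro _ ⟨γ, hγ, rfl⟩
  exact h γ hγ

theorem orbit_injective {la : Part N} (hla : StrictAnti la.1) :
    Function.Injective fun g : Equiv.Perm (Fin N) =>
      (Finsupp.equivFunOnFinite.symm la.1).mapDomain g := by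
  intro g h hgh
  have hinv : g.symm = h.symm := by
    ext1 i
    have := DFunLike.congr_fun hgh i
    simp only [Finsupp.mapDomain_equiv_apply] at this
    exact hla.injective this
  rw [← Equiv.symm_symm g, hinv, Equiv.symm_symm]

/-- The basis of `V_λ` that consists of the monomials `x^(g λ)`, when `λ` has distinct parts. -/
def orbitBasis (K : Type*) [Field K] {la : Part N} (hla : StrictAnti la.1) :
    Module.Basis (Equiv.Perm (Fin N)) K (V K la) :=
  Module.Basis.mk (v := fun g => (⟨orbitMonomial K la g, orbitMonomial_mem_V la g⟩ : V K la))
    (by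
      have h := (basisMonomials (Fin N) K).linearIndependent.comp _ (orbit_injective hla)
      rw [coe_basisMonomials] at h
      exact LinearIndependent.of_comp (V K la).subtype h)
    (by
      have hle : V K la ≤ (Submodule.span K (Set.range fun g =>
          (⟨orbitMonomial K la g, orbitMonomial_mem_V la g⟩ : V K la))).map
            (V K la).subtype := by
        refine V_le fun γ hγ => ?_
        refine ⟨⟨orbitMonomial K la (sortPerm γ), orbitMonomial_mem_V la _⟩,
          Submodule.subset_span ⟨_, rfl⟩, ?_⟩
        change orbitMonomial K la (sortPerm γ) = _
        rw [orbitMonomial, ← hγ, mapDomain_sortPerm]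
      rintro w -
      obtain ⟨x, hx, hxw⟩ := hle w.2
      rwa [← Subtype.ext hxw])

theorem orbitBasis_apply {la : Part N} (hla : StrictAnti la.1) (g : Equiv.Perm (Fin N)) :
    (orbitBasis K hla g : MvPolynomial (Fin N) K) = orbitMonomial K la g := by
  rw [orbitBasis, Module.Basis.mk_apply]

variable (θ : K)

/-- The operator induced on `V_λ` by the leading part of `P_m`. -/
def leadHpV (la : Part N) (m : ℕ) : Module.End K (V K la) :=
  (leadHp θ m).restrict fun _ hf => leadHp_mem_V θ m hf

theorem leadHpV_orbitBasis {la : Part N} (hla : StrictAnti la.1) (m : ℕ)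
    (g : Equiv.Perm (Fin N)) :
    leadHpV θ la m (orbitBasis K hla g) =
      ∑ p, ∑ B ∈ (Finset.Iio p).powerset, pathWeight θ (shifted θ la) m (insert p B) •
        orbitBasis K hla (g * descCycle (insert p B)) := by
  apply Subtype.ext
  rw [leadHpV, LinearMap.coe_restrict_apply, orbitBasis_apply, leadHp_orbitMonomial θ hla]
  simp [orbitBasis_apply]

/-- The operator induced on `V_λ` by the isotypical projection. -/
def isotypicSumV (la : Part N) (τ : IrrepClass K N) : Module.End K (V K la) :=
  (isotypicSum τ (polyRep K N)).restrict fun _ hf => isotypicSum_mem_V τ hf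

theorem isotypicSumV_orbitBasis {la : Part N} (hla : StrictAnti la.1) (τ : IrrepClass K N)
    (h : Equiv.Perm (Fin N)) :
    isotypicSumV la τ (orbitBasis K hla h) =
      ((τ.dim : K) / (Nat.card (Equiv.Perm (Fin N)) : K)) •
        ∑ g : Equiv.Perm (Fin N), τ.char g⁻¹ • orbitBasis K hla (g * h) := by
  apply Subtype.ext
  rw [isotypicSumV, LinearMap.coe_restrict_apply, orbitBasis_apply, isotypicSum_apply]
  simp [orbitBasis_apply, polyRep_apply, rename_orbitMonomial]

variable [CharZero K]

/-- All `N!` diagonal entries are equal, which cancels the denominator of the projection. -/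
theorem trace_leadHpV_isotypicSumV {la : Part N} (hla : StrictAnti la.1) (τ : IrrepClass K N)
    (m : ℕ) :
    LinearMap.trace K (V K la) (leadHpV θ la m * isotypicSumV la τ) =
      τ.dim * ∑ p, ∑ B ∈ (Finset.Iio p).powerset, pathWeight θ (shifted θ la) m (insert p B) *
        τ.char (descCycle (insert p B)) := by
  classical
  rw [trace_eq_sum_repr (orbitBasis K hla)]
  have hterm : ∀ h : Equiv.Perm (Fin N), (orbitBasis K hla).repr
      ((leadHpV θ la m * isotypicSumV la τ) (orbitBasis K hla h)) h =
      ((τ.dim : K) / (Nat.card (Equiv.Perm (Fin N)) : K)) *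
        ∑ p, ∑ B ∈ (Finset.Iio p).powerset, pathWeight θ (shifted θ la) m (insert p B) *
          τ.char (descCycle (insert p B)) := by
    intro h
    -- Left multiplication by `g` and right multiplication by `c` fix `h` only for `g = h c⁻¹ h⁻¹`,
    -- whose inverse is conjugate to `c`.
    have hg : ∀ c : Equiv.Perm (Fin N), ∑ g : Equiv.Perm (Fin N),
        τ.char g⁻¹ * (if g * h * c = h then 1 else 0) = τ.char c := by
      intro c
      rw [Finset.sum_eq_single (h * c⁻¹ * h⁻¹)]
      · rw [if_pos (by group), mul_one]
        exact τ.char_conj (isConj_iff.mpr ⟨h⁻¹, by group⟩)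
      · intro g _ hne
        rw [if_neg, mul_zero]
        intro heq
        exact hne (eq_mul_inv_of_mul_eq (eq_mul_inv_of_mul_eq heq))
      · simp
    rw [Module.End.mul_apply, isotypicSumV_orbitBasis, map_smul, map_sum, map_smul,
      Finsupp.smul_apply, smul_eq_mul]
    congr 1
    simp only [map_smul, leadHpV_orbitBasis, map_sum, Module.Basis.repr_self, Finsupp.coe_finsetSum,
      Finset.sum_apply, Finsupp.smul_apply, smul_eq_mul, Finsupp.single_apply, Finset.mul_sum]
    rw [Finset.sum_comm]
    refine Finset.sum_congr rfl fun p _ => ?_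
    rw [Finset.sum_comm]
    refine Finset.sum_congr rfl fun B _ => ?_
    rw [← hg, Finset.mul_sum]
    refine Finset.sum_congr rfl fun g _ => ?_
    ring
  rw [Finset.sum_congr rfl fun h _ => hterm h, Finset.sum_const, Finset.card_univ,
    ← Nat.card_eq_fintype_card, nsmul_eq_mul, ← mul_assoc,
    mul_div_cancel₀ _ card_perm_ne_zero]

variable [IsAlgClosed K]

theorem isotypicSum_mem_isotypic {la : Part N} (τ : IrrepClass K N) {f : MvPolynomial (Fin N) K}
    (hf : f ∈ V K la) : isotypicSum τ (polyRep K N) f ∈ isotypic la τ := by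
  classical
  suffices (⨆ σ : IrrepClass K N, isotypic la σ) ≤
    (isotypic la τ).comap (isotypicSum τ (polyRep K N)) from this (V_le_iSup_isotypic la hf)
  refine iSup_le fun σ w hw => ?_
  rw [Submodule.mem_comap, isotypicSum_of_mem_isotypic τ hw]
  split_ifs with h
  · exact h ▸ hw
  · exact Submodule.zero_mem _

theorem IsEigensystem.sum_eigenvalues {F : Family K N} (hF : IsEigensystem θ F) {la : Part N}
    (hla : StrictAnti la.1) (τ : IrrepClass K N) (m : ℕ)
    (eig : Fin (Module.finrank K (isotypic la τ)) → K)
    (heig : ∀ i, hpOp θ m (F la τ i) = eig i • F la τ i) :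
    ∑ i, eig i = (τ.dim : K) * ∑ k ∈ Finset.Icc 1 (min (m + 1) N),
      (-θ) ^ (k - 1) * hSub k (m + 1 - k) (shifted θ la) * τ.char (firstCycle N k) := by
  classical
  rw [← sum_pathWeight θ m τ.char fun g h => τ.char_conj, ← trace_leadHpV_isotypicSumV θ hla]
  let ι : isotypic la τ →ₗ[K] V K la := Submodule.inclusion (isotypic_le_V la τ)
  let π : V K la →ₗ[K] isotypic la τ :=
    ((isotypicSum τ (polyRep K N)).domRestrict (V K la)).codRestrict (isotypic la τ)
      fun f => isotypicSum_mem_isotypic τ f.2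
  -- Factoring the projection through its image lets cyclicity of the trace move the computation to
  -- `V_{λ;τ}`, where the leading parts are a basis of eigenvectors.
  have hfac : isotypicSumV la τ = ι ∘ₗ π := rfl
  rw [hfac, Module.End.mul_eq_comp, ← LinearMap.comp_assoc, LinearMap.trace_comp_comm',
    trace_eq_sum_repr (hF.leadBasis la τ)]
  refine Finset.sum_congr rfl fun i _ => ?_
  have h1 : leadHp θ m (lead K la (F la τ i)) = eig i • lead K la (F la τ i) := by
    rw [← lead_hpOp θ m (hF.mem_domSpan la τ i), heig, map_smul]
  have h2 : (π ∘ₗ leadHpV θ la m ∘ₗ ι) (hF.leadBasis la τ i) = eig i • hF.leadBasis la τ i := by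
    apply Subtype.ext
    change isotypicSum τ (polyRep K N) (leadHp θ m (hF.leadBasis la τ i)) = _
    rw [Submodule.coe_smul, hF.leadBasis_apply, h1, map_smul,
      isotypicSum_of_mem_isotypic τ (hF.lead_mem la τ i), if_pos rfl]
  rw [h2, map_smul, Module.Basis.repr_self]
  simp

end Trace

/-! ### Diagonalizable families of operators -/

section Diagonalizable

variable {K M : Type*} [Field K] [AddCommGroup M] [Module K M]

/-- The hypothesis says `ker (T - c)^2 = ker (T - c)`, so the exponent can be lowered one at a time.
-/
theorem apply_eq_smul_of_mem_maxGenEigenspace {T : Module.End K M} {c : K}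
    (hss : ∀ f, T (T f - c • f) = c • (T f - c • f) → T f = c • f) {f : M}
    (hf : f ∈ T.maxGenEigenspace c) : T f = c • f := by
  obtain ⟨k, hk⟩ := (Module.End.mem_maxGenEigenspace T c f).mp hf
  clear hf
  induction k generalizing f with
  | zero =>
    rw [pow_zero, Module.End.one_apply] at hk
    simp [hk]
  | succ k ih =>
    rw [pow_succ, Module.End.mul_apply] at hk
    exact hss f (ih hk)

/-- On a finite-dimensional invariant subspace, commuting operators without Jordan blocks have
enough joint eigenvectors. -/
theorem le_iSup_inf_iInf_eigenspace [IsAlgClosed K] {ι : Type*} (T : ι → Module.End K M)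
    (hcomm : ∀ i j, Commute (T i) (T j)) (W : Submodule K M) [FiniteDimensional K W]
    (hW : ∀ i, ∀ f ∈ W, T i f ∈ W)
    (hss : ∀ (i : ι) (c : K), ∀ f ∈ W, T i (T i f - c • f) = c • (T i f - c • f) → T i f = c • f) :
    W ≤ ⨆ χ : ι → K, W ⊓ ⨅ i, (T i).eigenspace (χ i) := by
  let R : ι → Module.End K W := fun i => (T i).restrict (hW i)
  have htop := Module.End.iSup_iInf_maxGenEigenspace_eq_top_of_iSup_maxGenEigenspace_eq_top_of_commute
    R (fun i j _ => LinearMap.ext fun w => Subtype.ext (LinearMap.congr_fun (hcomm i j) (w : M)))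
    fun i => Module.End.iSup_maxGenEigenspace_eq_top (R i)
  intro w hw
  have hmem : (⟨w, hw⟩ : W) ∈ ⨆ χ : ι → K, ⨅ i, (R i).maxGenEigenspace (χ i) := by
    rw [htop]
    exact Submodule.mem_top
  suffices (⨆ χ : ι → K, ⨅ i, (R i).maxGenEigenspace (χ i)) ≤
    (⨆ χ : ι → K, W ⊓ ⨅ i, (T i).eigenspace (χ i)).comap W.subtype from this hmem
  refine iSup_le fun χ x hx => ?_
  refine le_iSup (fun χ : ι → K => W ⊓ ⨅ i, (T i).eigenspace (χ i)) χ
    (⟨x.2, (Submodule.mem_iInf _).mpr fun i => Module.End.mem_eigenspace_iff.mpr ?_⟩)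
  have h := apply_eq_smul_of_mem_maxGenEigenspace (T := R i) (c := χ i) (fun f hf =>
    Subtype.ext (hss i (χ i) f f.2 (congrArg Subtype.val hf))) ((Submodule.mem_iInf _).mp hx i)
  exact congrArg Subtype.val h

/-- A symmetric operator for an anisotropic sesquilinear form has no Jordan blocks. -/
theorem apply_eq_smul_of_symmetric {E : Type*} [AddCommGroup E] [Module ℂ E]
    (H : E →ₗ⋆[ℂ] E →ₗ[ℂ] ℂ) (S : Submodule ℂ E) (T : Module.End ℂ E) (hT : ∀ f ∈ S, T f ∈ S)
    (hsymm : ∀ f ∈ S, ∀ g ∈ S, H (T f) g = H f (T g)) (hH : ∀ f ∈ S, H f f = 0 → f = 0) (c : ℂ)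
    (f : E) (hf : f ∈ S) (h : T (T f - c • f) = c • (T f - c • f)) : T f = c • f := by
  set g := T f - c • f with hg
  have hgS : g ∈ S := S.sub_mem (hT f hf) (S.smul_mem c hf)
  by_contra hne
  have hg0 : H g g ≠ 0 := fun h0 => hne (sub_eq_zero.mp (hH g hgS h0))
  -- The eigenvector `g` is not isotropic, so its eigenvalue is real; then `H g g = H f ((T - c) g)
  -- = 0`.
  have hreal : (starRingEnd ℂ) c = c := by
    have := hsymm g hgS g hgS
    rw [h, map_smulₛₗ, LinearMap.smul_apply, map_smul, smul_eq_mul, smul_eq_mul] at this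
    exact mul_right_cancel₀ hg0 this
  apply hg0
  have h1 : H g g = H (T f) g - (starRingEnd ℂ) c * H f g := by
    have h2 : H g = H (T f) - (starRingEnd ℂ) c • H f := by rw [hg, map_sub, map_smulₛₗ]
    rw [h2, LinearMap.sub_apply, LinearMap.smul_apply, smul_eq_mul]
  rw [h1, hsymm f hf g hgS, h, map_smul, smul_eq_mul, hreal, sub_self]

end Diagonalizable

/-! ### The bilinear form of the Dunkl operators -/

section BilinearForm

variable {K : Type*} [Field K] {N : ℕ} (θ : K)

open scoped IsMulCommutative in
-- The algebra `A` need not be commutative, but the subalgebra generated by the `a i` is, and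
-- evaluation takes place there.
theorem exists_algHom_of_commute {σ A : Type*} [Ring A] [Algebra K A] (a : σ → A)
    (ha : ∀ i j, a i * a j = a j * a i) :
    ∃ φ : MvPolynomial σ K →ₐ[K] A, ∀ i, φ (X i) = a i := by
  have hcomm : ∀ x ∈ Set.range a, ∀ y ∈ Set.range a, x * y = y * x := by
    rintro _ ⟨i, rfl⟩ _ ⟨j, rfl⟩
    exact ha i j
  have := Algebra.isMulCommutative_adjoin K hcomm
  refine ⟨(Algebra.adjoin K (Set.range a)).val.comp
    (aeval fun i => ⟨a i, Algebra.subset_adjoin ⟨i, rfl⟩⟩), fun i => ?_⟩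
  simp

theorem dunkl_mul_comm (i j : Fin N) : dunkl θ i * dunkl θ j = dunkl θ j * dunkl θ i := by
  refine LinearMap.ext fun f => ?_
  rw [Module.End.mul_apply, Module.End.mul_apply, dunkl_comm]

/-- The substitution `x_i ↦ D_i`. -/
def dunklHom : MvPolynomial (Fin N) K →ₐ[K] Module.End K (MvPolynomial (Fin N) K) :=
  (exists_algHom_of_commute (dunkl θ) (dunkl_mul_comm θ)).choose

theorem dunklHom_X (i : Fin N) : dunklHom θ (X i : MvPolynomial (Fin N) K) = dunkl θ i :=
  (exists_algHom_of_commute (dunkl θ) (dunkl_mul_comm θ)).choose_spec i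

/-- The bilinear form `(f(D) g)(0)`. -/
def dunklForm (f g : MvPolynomial (Fin N) K) : K := constantCoeff (dunklHom θ f g)

variable {θ}

theorem dunklForm_add_left (f g h : MvPolynomial (Fin N) K) :
    dunklForm θ (f + g) h = dunklForm θ f h + dunklForm θ g h := by
  simp [dunklForm]

theorem dunklForm_add_right (f g h : MvPolynomial (Fin N) K) :
    dunklForm θ f (g + h) = dunklForm θ f g + dunklForm θ f h := by
  simp [dunklForm]

theorem dunklForm_smul_left (c : K) (f g : MvPolynomial (Fin N) K) :
    dunklForm θ (c • f) g = c * dunklForm θ f g := by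
  rw [dunklForm, map_smul, LinearMap.smul_apply, smul_eq_C_mul, map_mul, constantCoeff_C, dunklForm]

theorem dunklForm_smul_right (c : K) (f g : MvPolynomial (Fin N) K) :
    dunklForm θ f (c • g) = c * dunklForm θ f g := by
  rw [dunklForm, map_smul, smul_eq_C_mul, map_mul, constantCoeff_C, dunklForm]

theorem dunklForm_sub_left (f g h : MvPolynomial (Fin N) K) :
    dunklForm θ (f - g) h = dunklForm θ f h - dunklForm θ g h := by
  simp [dunklForm]

theorem dunklForm_sub_right (f g h : MvPolynomial (Fin N) K) :
    dunklForm θ f (g - h) = dunklForm θ f g - dunklForm θ f h := by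
  simp [dunklForm]

theorem dunklForm_sum_left {ι : Type*} (s : Finset ι) (f : ι → MvPolynomial (Fin N) K)
    (g : MvPolynomial (Fin N) K) : dunklForm θ (∑ i ∈ s, f i) g = ∑ i ∈ s, dunklForm θ (f i) g := by
  simp [dunklForm, LinearMap.sum_apply]

theorem dunklForm_sum_right {ι : Type*} (s : Finset ι) (f : MvPolynomial (Fin N) K)
    (g : ι → MvPolynomial (Fin N) K) :
    dunklForm θ f (∑ i ∈ s, g i) = ∑ i ∈ s, dunklForm θ f (g i) := by
  simp [dunklForm]

theorem dunklForm_C_left (a : K) (f : MvPolynomial (Fin N) K) :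
    dunklForm θ (C a) f = a * constantCoeff f := by
  rw [dunklForm, ← algebraMap_eq, AlgHom.commutes, Module.algebraMap_end_apply, smul_eq_C_mul,
    map_mul, constantCoeff_C]

theorem dunklForm_X_mul_left (i : Fin N) (f g : MvPolynomial (Fin N) K) :
    dunklForm θ (X i * f) g = dunklForm θ f (dunkl θ i g) := by
  rw [dunklForm, mul_comm, map_mul, dunklHom_X]
  rfl

theorem dunklHom_rename (g : Equiv.Perm (Fin N)) (f h : MvPolynomial (Fin N) K) :
    dunklHom θ (rename g f) (rename g h) = rename g (dunklHom θ f h) := by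
  induction f using MvPolynomial.induction_on generalizing h with
  | C a =>
    simp only [← algebraMap_eq, AlgHom.commutes, Module.algebraMap_end_apply, map_smul]
  | add p q hp hq => simp only [map_add, LinearMap.add_apply, hp, hq]
  | mul_X p i ih =>
    rw [map_mul, map_mul, map_mul, rename_X, dunklHom_X, dunklHom_X, Module.End.mul_apply,
      Module.End.mul_apply, dunkl_rename, ih]

theorem dunklForm_rename (g : Equiv.Perm (Fin N)) (f h : MvPolynomial (Fin N) K) :
    dunklForm θ (rename g f) (rename g h) = dunklForm θ f h := by
  rw [dunklForm, dunklHom_rename, constantCoeff_rename, dunklForm]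

theorem rename_swap_rename_swap (i j : Fin N) (f : MvPolynomial (Fin N) K) :
    rename (Equiv.swap i j) (rename (Equiv.swap i j) f) = f := by
  rw [rename_rename, ← Equiv.Perm.coe_mul, Equiv.swap_mul_self]
  exact rename_id_apply f

theorem dunklForm_rename_swap (i j : Fin N) (f h : MvPolynomial (Fin N) K) :
    dunklForm θ (rename (Equiv.swap i j) f) h = dunklForm θ f (rename (Equiv.swap i j) h) := by
  rw [← dunklForm_rename (Equiv.swap i j), rename_swap_rename_swap]

/-- Adjointness of `X i` and `D_i` in the other slot, by induction on `g`. It works because `[D_i,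
X_j]` is self-adjoint and symmetric in `i` and `j`, being built from transpositions. -/
theorem dunklForm_dunkl_left (i : Fin N) (g f : MvPolynomial (Fin N) K) :
    dunklForm θ (dunkl θ i g) f = dunklForm θ g (X i * f) := by
  induction g using MvPolynomial.induction_on generalizing i f with
  | C a => simp [dunkl_C, dunklForm]
  | add p q hp hq => rw [map_add, dunklForm_add_left, hp, hq, dunklForm_add_left]
  | mul_X h j ih =>
    rw [mul_comm h, dunklForm_X_mul_left]
    rcases eq_or_ne j i with rfl | hji
    · rw [dunkl_X_mul_self, dunkl_X_mul_self, dunklForm_add_left, dunklForm_add_left,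
        dunklForm_add_right, dunklForm_add_right, dunklForm_X_mul_left, ih, dunklForm_smul_left,
        dunklForm_smul_right, dunklForm_sum_left, dunklForm_sum_right]
      simp only [dunklForm_rename_swap]
    · rw [dunkl_X_mul_of_ne θ hji, dunkl_X_mul_of_ne θ hji.symm, dunklForm_sub_left,
        dunklForm_sub_right, dunklForm_X_mul_left, ih, dunklForm_smul_left, dunklForm_smul_right,
        dunklForm_rename_swap, Equiv.swap_comm]

theorem dunklForm_heck_left (i : Fin N) (f g : MvPolynomial (Fin N) K) :
    dunklForm θ (heck θ i f) g = dunklForm θ f (heck θ i g) := by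
  rw [heck_apply, heck_apply, dunklForm_X_mul_left, dunklForm_dunkl_left]

theorem dunklForm_heck_right (i : Fin N) (f g : MvPolynomial (Fin N) K) :
    dunklForm θ f (heck θ i g) = dunklForm θ (dunkl θ i f) (dunkl θ i g) := by
  rw [heck_apply, dunklForm_dunkl_left]

theorem dunklForm_hpOp_left (m : ℕ) (f g : MvPolynomial (Fin N) K) :
    dunklForm θ (hpOp θ m f) g = dunklForm θ f (hpOp θ m g) := by
  have hpow : ∀ i (f g : MvPolynomial (Fin N) K),
      dunklForm θ ((heck θ i ^ m) f) g = dunklForm θ f ((heck θ i ^ m) g) := by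
    intro i
    induction m with
    | zero => simp
    | succ m ih =>
      intro f g
      rw [pow_succ, Module.End.mul_apply, ih, dunklForm_heck_left, ← Module.End.mul_apply,
        ← pow_succ', pow_succ]
  rw [hpOp_eq, LinearMap.sum_apply, LinearMap.sum_apply, dunklForm_sum_left, dunklForm_sum_right]
  exact Finset.sum_congr rfl fun i _ => hpow i f g

theorem map_divDiff (φ : K →+* K) {i j : Fin N} (hij : i ≠ j) (f : MvPolynomial (Fin N) K) :
    divDiff K i j (map φ f) = map φ (divDiff K i j f) := by
  apply divDiff_eq hij
  have := congrArg (map φ) (mul_divDiff i j f)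
  rw [map_mul, map_sub, map_sub, map_X, map_X, map_rename] at this
  exact this

theorem dunkl_map (φ : K →+* K) (hφ : φ θ = θ) (i : Fin N) (f : MvPolynomial (Fin N) K) :
    dunkl θ i (map φ f) = map φ (dunkl θ i f) := by
  rw [dunkl_apply, dunkl_apply, pderiv_map, map_add, smul_eq_C_mul, smul_eq_C_mul, map_mul, map_C,
    hφ, map_sum]
  congr 2
  exact Finset.sum_congr rfl fun j hj => map_divDiff φ (Finset.ne_of_mem_erase hj).symm f

theorem hpOp_map (φ : K →+* K) (hφ : φ θ = θ) (m : ℕ) (f : MvPolynomial (Fin N) K) :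
    hpOp θ m (map φ f) = map φ (hpOp θ m f) := by
  have hpow : ∀ i, (heck θ i ^ m) (map φ f) = map φ ((heck θ i ^ m) f) := by
    intro i
    induction m with
    | zero => simp
    | succ m ih =>
      rw [pow_succ', Module.End.mul_apply, Module.End.mul_apply, ih, heck_apply, heck_apply,
        dunkl_map φ hφ, map_mul, map_X]
  rw [hpOp_eq, LinearMap.sum_apply, LinearMap.sum_apply, map_sum]
  exact Finset.sum_congr rfl fun i _ => hpow i

end BilinearForm

/-! ### Homogeneous components -/

section Homogeneous

variable {K : Type*} [Field K] {N : ℕ} (θ : K)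

theorem isHomogeneous_of_mem_domSpan {la : Part N} {f : MvPolynomial (Fin N) K}
    (hf : f ∈ domSpan K la) : f.IsHomogeneous (∑ j, la.1 j) := by
  rw [← mem_homogeneousSubmodule, homogeneousSubmodule_eq_finsupp_supported]
  intro γ hγ
  have h := (hf hγ).1
  rw [sum_sortDesc] at h
  rw [Set.mem_ofPred_eq, Finsupp.degree_eq_sum, h]

theorem homogeneousSubmodule_le {d : ℕ} {W : Submodule K (MvPolynomial (Fin N) K)}
    (h : ∀ γ : Fin N →₀ ℕ, ∑ i, γ i = d → monomial γ (1 : K) ∈ W) :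
    homogeneousSubmodule (Fin N) K d ≤ W := by
  rw [homogeneousSubmodule_eq_finsupp_supported]
  refine restrictSupport_induction (s := {γ | γ.degree = d}) fun γ hγ => h γ ?_
  rw [← Finsupp.degree_eq_sum]
  exact hγ

theorem heck_isHomogeneous {d : ℕ} (i : Fin N) {f : MvPolynomial (Fin N) K}
    (hf : f.IsHomogeneous d) : (heck θ i f).IsHomogeneous d := by
  suffices homogeneousSubmodule (Fin N) K d ≤
    (homogeneousSubmodule (Fin N) K d).comap (heck θ i) from this hf
  refine homogeneousSubmodule_le fun γ hγ => ?_
  have := isHomogeneous_of_mem_domSpan (heck_monomial_mem_domSpan θ i γ)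
  rwa [sum_sortDesc, hγ] at this

theorem hpOp_isHomogeneous {d : ℕ} (m : ℕ) {f : MvPolynomial (Fin N) K}
    (hf : f.IsHomogeneous d) : (hpOp θ m f).IsHomogeneous d := by
  have hpow : ∀ i, ((heck θ i ^ m) f).IsHomogeneous d := by
    intro i
    induction m with
    | zero => simpa using hf
    | succ m ih =>
      rw [pow_succ', Module.End.mul_apply]
      exact heck_isHomogeneous θ i ih
  rw [hpOp_eq, LinearMap.sum_apply]
  exact IsHomogeneous.sum _ _ _ fun i _ => hpow i

theorem dunkl_isHomogeneous {d : ℕ} (i : Fin N) {f : MvPolynomial (Fin N) K}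
    (hf : f.IsHomogeneous (d + 1)) : (dunkl θ i f).IsHomogeneous d := by
  rw [← mem_homogeneousSubmodule, homogeneousSubmodule_eq_finsupp_supported]
  intro γ hγ
  -- Multiplication by `X i` only shifts exponents, so the degree is read off from `x_i D_i f`.
  have h1 : coeff (Finsupp.single i 1 + γ) (heck θ i f) ≠ 0 := by
    rw [heck_apply, coeff_X_mul]
    exact mem_support_iff.mp hγ
  by_contra hne
  refine h1 ((heck_isHomogeneous θ i hf).coeff_eq_zero fun h => hne ?_)
  rw [map_add, Finsupp.degree_single] at h
  change γ.degree = d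
  omega

instance homogeneousSubmodule_finiteDimensional (d : ℕ) :
    FiniteDimensional K (homogeneousSubmodule (Fin N) K d) := by
  have hfin : {γ : Fin N →₀ ℕ | ∑ i, γ i = d}.Finite :=
    (Finset.finite_toSet (Finset.finsuppAntidiag Finset.univ d)).subset fun γ hγ => by
      simpa using hγ
  have : FiniteDimensional K (Submodule.span K
      ((fun γ : Fin N →₀ ℕ => monomial γ (1 : K)) '' {γ | ∑ i, γ i = d})) :=
    FiniteDimensional.span_of_finite K (hfin.image _)
  exact Submodule.finiteDimensional_of_le (S₂ := Submodule.span K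
    ((fun γ : Fin N →₀ ℕ => monomial γ (1 : K)) '' {γ | ∑ i, γ i = d})) (homogeneousSubmodule_le fun γ hγ =>
    Submodule.subset_span ⟨γ, hγ, rfl⟩)

/-- Euler's identity gives the degree. Adding the terms for `(i,j)` and `(j,i)` replaces `x_i` by
`x_i - x_j`, which cancels the denominator. So in fixed degree `P_1` is a combination of
transpositions. -/
theorem two_smul_hpOp_one {d : ℕ} {f : MvPolynomial (Fin N) K} (hf : f.IsHomogeneous d) :
    (2 : K) • hpOp θ 1 f = (2 * d : K) • f + θ • ∑ i, ∑ j ∈ Finset.univ.erase i,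
      (f - rename (Equiv.swap i j) f) := by
  have hneg : ∀ i j, i ≠ j → divDiff K j i f = - divDiff K i j f := by
    intro i j hij
    apply divDiff_eq hij.symm
    have := mul_divDiff i j f
    rw [Equiv.swap_comm] at this
    rw [← this]
    ring
  have hsymm : (2 : K) • ∑ i, ∑ j ∈ Finset.univ.erase i, X i * divDiff K i j f =
      ∑ i, ∑ j ∈ Finset.univ.erase i, (f - rename (Equiv.swap i j) f) := by
    rw [two_smul]
    conv_lhs =>
      arg 2
      rw [Finset.sum_comm' (t' := Finset.univ) (s' := fun j => Finset.univ.erase j)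
        (by simp [eq_comm])]
    rw [← Finset.sum_add_distrib]
    refine Finset.sum_congr rfl fun i _ => ?_
    rw [← Finset.sum_add_distrib]
    refine Finset.sum_congr rfl fun j hj => ?_
    rw [hneg i j (Finset.ne_of_mem_erase hj).symm, ← mul_divDiff]
    ring
  have heuler := hf.sum_X_mul_pderiv
  rw [← hsymm, hpOp_eq, LinearMap.sum_apply]
  simp only [pow_one, heck_apply, dunkl_apply, mul_add, mul_smul_comm, Finset.sum_add_distrib,
    Finset.mul_sum, ← Finset.smul_sum]
  rw [heuler, smul_add, ← Nat.cast_smul_eq_nsmul K, smul_smul, smul_smul, smul_smul, mul_comm θ]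

end Homogeneous

/-! ### Positivity of the Hermitian form of the Dunkl operators -/

section Positivity

open scoped ComplexOrder

variable {N : ℕ}

/-- The standard Hermitian form on homogeneous polynomials of degree `d`. -/
def stdForm (N d : ℕ) : MvPolynomial (Fin N) ℂ →ₗ⋆[ℂ] MvPolynomial (Fin N) ℂ →ₗ[ℂ] ℂ :=
  LinearMap.mk₂'ₛₗ (starRingEnd ℂ) (RingHom.id ℂ)
    (fun f g => ∑ γ ∈ Finset.finsuppAntidiag Finset.univ d,
      (starRingEnd ℂ) (coeff γ f) * coeff γ g)
    (fun f g h => by simp only [coeff_add, map_add, add_mul, Finset.sum_add_distrib])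
    (fun c f g => by
      simp only [coeff_smul, smul_eq_mul, map_mul, mul_assoc, Finset.mul_sum])
    (fun f g h => by simp only [coeff_add, mul_add, Finset.sum_add_distrib])
    (fun c f g => by
      simp only [coeff_smul, smul_eq_mul, RingHom.id_apply, Finset.mul_sum, mul_left_comm])

theorem stdForm_apply (d : ℕ) (f g : MvPolynomial (Fin N) ℂ) :
    stdForm N d f g = ∑ γ ∈ Finset.finsuppAntidiag Finset.univ d,
      (starRingEnd ℂ) (coeff γ f) * coeff γ g := rfl

theorem stdForm_self_nonneg (d : ℕ) (f : MvPolynomial (Fin N) ℂ) : 0 ≤ stdForm N d f f :=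
  Finset.sum_nonneg fun _ _ => star_mul_self_nonneg _

theorem stdForm_self_eq_zero {d : ℕ} {f : MvPolynomial (Fin N) ℂ} (hf : f.IsHomogeneous d)
    (h : stdForm N d f f = 0) : f = 0 := by
  have hnonneg : ∀ γ ∈ Finset.finsuppAntidiag Finset.univ d,
      0 ≤ (starRingEnd ℂ) (coeff γ f) * coeff γ f := fun _ _ => star_mul_self_nonneg _
  rw [stdForm_apply, Finset.sum_eq_zero_iff_of_nonneg hnonneg] at h
  ext γ
  rw [coeff_zero]
  by_contra hne
  have hdeg : γ.degree = d := by
    by_contra hd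
    exact hne (hf.coeff_eq_zero hd)
  rw [Finsupp.degree_eq_sum] at hdeg
  have := h γ (by simpa using hdeg)
  rw [mul_eq_zero, map_eq_zero, or_self] at this
  exact hne this

theorem stdForm_rename (d : ℕ) (σ : Equiv.Perm (Fin N)) (f g : MvPolynomial (Fin N) ℂ) :
    stdForm N d (rename σ f) (rename σ g) = stdForm N d f g := by
  rw [stdForm_apply, stdForm_apply]
  symm
  refine Finset.sum_equiv (Finsupp.domCongr (M := ℕ) σ).toEquiv (fun γ => ?_) fun γ _ => ?_
  · have h : ∑ i, Finsupp.equivMapDomain σ γ i = ∑ i, γ i :=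
      Equiv.sum_comp σ.symm γ
    simp [h]
  · have h : (Finsupp.domCongr (M := ℕ) σ).toEquiv γ = γ.mapDomain σ :=
      Finsupp.equivMapDomain_eq_mapDomain σ γ
    rw [h, coeff_rename_mapDomain _ σ.injective, coeff_rename_mapDomain _ σ.injective]

theorem stdForm_rename_swap (d : ℕ) (i j : Fin N) (f g : MvPolynomial (Fin N) ℂ) :
    stdForm N d (rename (Equiv.swap i j) f) g = stdForm N d f (rename (Equiv.swap i j) g) := by
  rw [← stdForm_rename d (Equiv.swap i j), rename_swap_rename_swap]

/-- With `s` the transposition, `1 - s` is self-adjoint and `(1 - s)^2 = 2 (1 - s)`. -/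
theorem stdForm_sub_rename_swap_nonneg (d : ℕ) (i j : Fin N) (f : MvPolynomial (Fin N) ℂ) :
    0 ≤ stdForm N d f (f - rename (Equiv.swap i j) f) := by
  have h := stdForm_self_nonneg d (f - rename (Equiv.swap i j) f)
  have h2 : stdForm N d (f - rename (Equiv.swap i j) f) (f - rename (Equiv.swap i j) f) =
      2 * stdForm N d f (f - rename (Equiv.swap i j) f) := by
    rw [map_sub (stdForm N d), LinearMap.sub_apply, stdForm_rename_swap,
      map_sub (rename (R := ℂ) (Equiv.swap i j)),
      rename_swap_rename_swap, ← neg_sub f, map_neg]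
    ring
  rw [h2] at h
  exact le_of_mul_le_mul_left (by rwa [mul_zero]) (two_pos (α := ℂ))

theorem stdForm_hpOp_one (θ : ℝ) {d : ℕ} {f g : MvPolynomial (Fin N) ℂ} (hf : f.IsHomogeneous d)
    (hg : g.IsHomogeneous d) :
    stdForm N d (hpOp (θ : ℂ) 1 f) g = stdForm N d f (hpOp (θ : ℂ) 1 g) := by
  have h2 : ∀ c : ℂ, (starRingEnd ℂ) c = c → ∀ p q : MvPolynomial (Fin N) ℂ,
      stdForm N d (c • p) q = c * stdForm N d p q := by
    intro c hc p q
    rw [map_smulₛₗ, LinearMap.smul_apply, hc, smul_eq_mul]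
  have key : stdForm N d ((2 : ℂ) • hpOp (θ : ℂ) 1 f) g =
      stdForm N d f ((2 : ℂ) • hpOp (θ : ℂ) 1 g) := by
    rw [two_smul_hpOp_one _ hf, two_smul_hpOp_one _ hg, map_add, LinearMap.add_apply, map_add,
      h2 _ (by rw [map_mul, map_ofNat, map_natCast]), h2 _ (Complex.conj_ofReal θ), map_smul, map_smul, smul_eq_mul, smul_eq_mul]
    congr 2
    simp only [map_sum, LinearMap.sum_apply, map_sub, LinearMap.sub_apply, stdForm_rename_swap]
  rw [h2 _ (map_ofNat _ 2), map_smul, smul_eq_mul] at key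
  exact mul_left_cancel₀ two_ne_zero key

theorem hpOp_one_eigenvalue_pos {θ : ℝ} (hθ : 0 < θ) {d : ℕ} {f : MvPolynomial (Fin N) ℂ}
    (hf : f.IsHomogeneous (d + 1)) (hne : f ≠ 0) {c : ℂ} (hc : hpOp (θ : ℂ) 1 f = c • f) :
    0 < c := by
  have hpos : 0 < stdForm N (d + 1) f f :=
    lt_of_le_of_ne (stdForm_self_nonneg _ f) fun h => hne (stdForm_self_eq_zero hf h.symm)
  have h := congrArg (stdForm N (d + 1) f) (two_smul_hpOp_one (θ : ℂ) hf)
  rw [hc, map_smul, map_smul, map_add, map_smul, map_smul, map_sum, smul_eq_mul, smul_eq_mul,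
    smul_eq_mul, smul_eq_mul] at h
  have hsum : 0 ≤ ∑ i, stdForm N (d + 1) f
      (∑ j ∈ Finset.univ.erase i, (f - rename (Equiv.swap i j) f)) :=
    Finset.sum_nonneg fun i _ => by
      rw [map_sum]
      exact Finset.sum_nonneg fun j _ => stdForm_sub_rename_swap_nonneg _ i j f
  have hθ' : (0 : ℂ) < θ := by exact_mod_cast hθ
  have hd : (0 : ℂ) < 2 * ((d + 1 : ℕ) : ℂ) := by
    have : (0 : ℝ) < 2 * ((d + 1 : ℕ) : ℝ) := by positivity
    exact_mod_cast this
  have h3 : 0 < 2 * (c * stdForm N (d + 1) f f) := by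
    rw [h]
    exact add_pos_of_pos_of_nonneg (mul_pos hd hpos) (mul_nonneg hθ'.le hsum)
  have h4 : 0 < c * stdForm N (d + 1) f f := pos_of_mul_pos_right h3 two_pos.le
  exact pos_of_mul_pos_left h4 hpos.le

/-- The Hermitian form `(f̄(D) g)(0)`. -/
def hermForm (N : ℕ) (θ : ℝ) : MvPolynomial (Fin N) ℂ →ₗ⋆[ℂ] MvPolynomial (Fin N) ℂ →ₗ[ℂ] ℂ :=
  LinearMap.mk₂'ₛₗ (starRingEnd ℂ) (RingHom.id ℂ)
    (fun f g => dunklForm (θ : ℂ) (map (starRingEnd ℂ) f) g)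
    (fun f g h => by rw [map_add, dunklForm_add_left])
    (fun c f g => by
      rw [smul_eq_C_mul, map_mul, map_C, ← smul_eq_C_mul, dunklForm_smul_left, smul_eq_mul])
    (fun f g h => dunklForm_add_right _ g h)
    (fun c f g => dunklForm_smul_right c _ g)

theorem hermForm_apply (θ : ℝ) (f g : MvPolynomial (Fin N) ℂ) :
    hermForm N θ f g = dunklForm (θ : ℂ) (map (starRingEnd ℂ) f) g := rfl

theorem hermForm_hpOp_left (θ : ℝ) (m : ℕ) (f g : MvPolynomial (Fin N) ℂ) :
    hermForm N θ (hpOp (θ : ℂ) m f) g = hermForm N θ f (hpOp (θ : ℂ) m g) := by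
  rw [hermForm_apply, ← hpOp_map _ (Complex.conj_ofReal θ), dunklForm_hpOp_left, hermForm_apply]

theorem hermForm_hpOp_one (θ : ℝ) (f : MvPolynomial (Fin N) ℂ) :
    hermForm N θ f (hpOp (θ : ℂ) 1 f) =
      ∑ i, hermForm N θ (dunkl (θ : ℂ) i f) (dunkl (θ : ℂ) i f) := by
  rw [hpOp_eq, LinearMap.sum_apply, map_sum]
  refine Finset.sum_congr rfl fun i _ => ?_
  rw [pow_one, hermForm_apply, dunklForm_heck_right, dunkl_map _ (Complex.conj_ofReal θ),
    hermForm_apply]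

/-- `P_1` is diagonalized with the standard form, since the positivity of `hermForm` is to be
deduced from this. -/
theorem homogeneous_le_iSup_eigenspace (θ : ℝ) (d : ℕ) :
    homogeneousSubmodule (Fin N) ℂ d ≤
      ⨆ c : ℂ, homogeneousSubmodule (Fin N) ℂ d ⊓ (hpOp (θ : ℂ) 1).eigenspace c := by
  refine (le_iSup_inf_iInf_eigenspace (fun _ : Unit => hpOp (N := N) (θ : ℂ) 1)
    (fun _ _ => Commute.refl _) _ (fun _ f hf => hpOp_isHomogeneous _ 1 hf) ?_).trans ?_
  · intro _ c f hf h
    exact apply_eq_smul_of_symmetric (stdForm N d) (homogeneousSubmodule (Fin N) ℂ d) _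
      (fun f hf => hpOp_isHomogeneous _ 1 hf) (fun f hf g hg => stdForm_hpOp_one θ hf hg)
      (fun f hf h => stdForm_self_eq_zero hf h) c f hf h
  · refine iSup_le fun χ => ?_
    rw [iInf_unique]
    exact le_iSup (fun c : ℂ => homogeneousSubmodule (Fin N) ℂ d ⊓
      (hpOp (θ : ℂ) 1).eigenspace c) (χ default)

/-- Induction on the degree. An eigenvector `g` of `P_1` with eigenvalue `c > 0` satisfies `c H(g,g)
= ∑ H(D_i g, D_i g)`, and the right side is positive by induction unless all `D_i g` vanish, which
would force `P_1 g = 0`. General `f` is an orthogonal sum of such eigenvectors. -/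
theorem hermForm_self_pos {θ : ℝ} (hθ : 0 < θ) (d : ℕ) (f : MvPolynomial (Fin N) ℂ)
    (hf : f.IsHomogeneous d) (hne : f ≠ 0) : 0 < hermForm N θ f f := by
  induction d generalizing f with
  | zero =>
    obtain ⟨a, rfl⟩ : ∃ a, f = C a := ⟨_, (totalDegree_eq_zero_iff_eq_C.mp
      (Nat.le_zero.mp hf.totalDegree_le))⟩
    have ha : a ≠ 0 := fun h => hne (by rw [h, map_zero])
    rw [hermForm_apply, map_C, dunklForm_C_left, constantCoeff_C]
    exact star_mul_self_pos (IsRegular.of_ne_zero ha)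
  | succ d ih =>
    have hnonneg : ∀ g : MvPolynomial (Fin N) ℂ, g.IsHomogeneous d → 0 ≤ hermForm N θ g g := by
      intro g hg
      by_cases h : g = 0
      · rw [h, map_zero]
      · exact (ih g hg h).le
    have heig : ∀ g : MvPolynomial (Fin N) ℂ, g.IsHomogeneous (d + 1) → g ≠ 0 → ∀ c : ℂ,
        hpOp (θ : ℂ) 1 g = c • g → 0 < hermForm N θ g g := by
      intro g hg hg0 c hc
      have hcpos := hpOp_one_eigenvalue_pos hθ hg hg0 hc
      have hsum := hermForm_hpOp_one θ g
      rw [hc, map_smul, smul_eq_mul] at hsum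
      have hterm : ∀ i ∈ Finset.univ, 0 ≤ hermForm N θ (dunkl (θ : ℂ) i g) (dunkl (θ : ℂ) i g) :=
        fun i _ => hnonneg _ (dunkl_isHomogeneous _ i hg)
      have hpos : 0 < c * hermForm N θ g g := by
        rw [hsum]
        refine lt_of_le_of_ne (Finset.sum_nonneg hterm) fun h0 => ?_
        have hzero := (Finset.sum_eq_zero_iff_of_nonneg hterm).mp h0.symm
        have hD : ∀ i, dunkl (θ : ℂ) i g = 0 := by
          intro i
          by_contra hi
          exact (ih _ (dunkl_isHomogeneous _ i hg) hi).ne' (hzero i (Finset.mem_univ i))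
        have hP : hpOp (θ : ℂ) 1 g = 0 := by
          rw [hpOp_eq, LinearMap.sum_apply]
          exact Finset.sum_eq_zero fun i _ => by rw [pow_one, heck_apply, hD, mul_zero]
        rw [hc] at hP
        exact (smul_eq_zero.mp hP).elim hcpos.ne' hg0
      exact pos_of_mul_pos_right hpos hcpos.le
    obtain ⟨c, hc, rfl⟩ := (Submodule.mem_iSup_iff_exists_finsupp _ _).mp
      (homogeneous_le_iSup_eigenspace θ (d + 1) hf)
    have hcE : ∀ x, hpOp (θ : ℂ) 1 (c x) = x • c x := fun x =>
      Module.End.mem_eigenspace_iff.mp (hc x).2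
    -- Symmetry of `P_1` separates distinct eigenvalues, which are real because they are positive.
    have horth : ∀ x y, x ≠ y → hermForm N θ (c x) (c y) = 0 := by
      intro x y hxy
      by_cases h0 : c x = 0
      · rw [h0, map_zero, LinearMap.zero_apply]
      have hx : (starRingEnd ℂ) x = x := by
        have := hpOp_one_eigenvalue_pos hθ (hc x).1 h0 (hcE x)
        rw [Complex.conj_eq_iff_im]
        exact (Complex.lt_def.mp this).2.symm
      have h := hermForm_hpOp_left θ 1 (c x) (c y)
      rw [hcE, hcE, map_smulₛₗ, LinearMap.smul_apply, map_smul, hx, smul_eq_mul, smul_eq_mul] at h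
      have h' : (x - y) * hermForm N θ (c x) (c y) = 0 := by rw [sub_mul, h, sub_self]
      exact (mul_eq_zero.mp h').resolve_left (sub_ne_zero.mpr hxy)
    have hexp : hermForm N θ (c.sum fun _ => id) (c.sum fun _ => id) =
        ∑ x ∈ c.support, hermForm N θ (c x) (c x) := by
      simp only [Finsupp.sum, id_eq, map_sum, LinearMap.sum_apply]
      refine Finset.sum_congr rfl fun x hx => ?_
      refine Finset.sum_eq_single x (fun y _ hyx => horth y x hyx) fun h => absurd hx h
    have hsupp : c.support.Nonempty := by
      rw [Finset.nonempty_iff_ne_empty]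
      intro h
      apply hne
      rw [Finsupp.sum, h, Finset.sum_empty]
    change 0 < hermForm N θ (c.sum fun _ => id) (c.sum fun _ => id)
    rw [hexp]
    exact Finset.sum_pos (fun x hx => heig _ (hc x).1 (Finsupp.mem_support_iff.mp hx) x (hcE x))
      hsupp

theorem hpOp_apply_eq_smul {θ : ℝ} (hθ : 0 < θ) (m : ℕ) {d : ℕ} (c : ℂ)
    {f : MvPolynomial (Fin N) ℂ} (hf : f.IsHomogeneous d)
    (h : hpOp (θ : ℂ) m (hpOp (θ : ℂ) m f - c • f) = c • (hpOp (θ : ℂ) m f - c • f)) :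
    hpOp (θ : ℂ) m f = c • f :=
  apply_eq_smul_of_symmetric (hermForm N θ) (homogeneousSubmodule (Fin N) ℂ d) _
    (fun _ hf => hpOp_isHomogeneous _ m hf) (fun f _ g _ => hermForm_hpOp_left θ m f g)
    (fun f hf h => by
      by_contra hne
      exact (hermForm_self_pos hθ d f hf hne).ne' h) c f hf h

end Positivity

/-! ### Existence of eigensystems -/

section Existence

/-- Equivariance on `V_λ` makes `leadHp` commute with the isotypical projection. -/
theorem leadHp_mem_isotypic {K : Type*} [Field K] [IsAlgClosed K] [CharZero K] {N : ℕ} (θ : K)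
    (m : ℕ) {la : Part N} {τ : IrrepClass K N} {f : MvPolynomial (Fin N) K}
    (hf : f ∈ isotypic la τ) : leadHp θ m f ∈ isotypic la τ := by
  classical
  have hV := isotypic_le_V la τ hf
  have h : isotypicSum τ (polyRep K N) (leadHp θ m f) =
      leadHp θ m (isotypicSum τ (polyRep K N) f) := by
    rw [isotypicSum_apply, isotypicSum_apply, map_smul, map_sum]
    congr 1
    refine Finset.sum_congr rfl fun g _ => ?_
    rw [map_smul, polyRep_apply, polyRep_apply, rename_leadHp θ m g hV]
  rw [isotypicSum_of_mem_isotypic τ hf, if_pos rfl] at h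
  rw [← h]
  exact isotypicSum_mem_isotypic τ (leadHp_mem_V θ m hV)

variable {N : ℕ}

/-- The polynomials in the span of the `x^γ` with `γ⁺ ⪯ λ` with leading part in `V_{λ;τ}`. -/
def isotypicLift {K : Type*} [Field K] (la : Part N) (τ : IrrepClass K N) :
    Submodule K (MvPolynomial (Fin N) K) :=
  domSpan K la ⊓ (isotypic la τ).comap (lead K la)

theorem isotypicLift_le_homogeneous {K : Type*} [Field K] (la : Part N) (τ : IrrepClass K N) :
    isotypicLift la τ ≤ homogeneousSubmodule (Fin N) K (∑ j, la.1 j) :=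
  fun _ hf => isHomogeneous_of_mem_domSpan hf.1

theorem span_lead_eq_isotypic {θ : ℝ} (hθ : 0 < θ) (la : Part N) (τ : IrrepClass ℂ N) :
    Submodule.span ℂ {v | ∃ f ∈ isotypicLift la τ, (∀ m, ∃ c : ℂ, hpOp (θ : ℂ) m f = c • f) ∧
      lead ℂ la f = v} = isotypic la τ := by
  apply le_antisymm
  · rw [Submodule.span_le]
    rintro _ ⟨f, hf, -, rfl⟩
    exact hf.2
  intro w hw
  have hwV := isotypic_le_V la τ hw
  have hwL : w ∈ isotypicLift la τ := by
    refine ⟨V_le_domSpan la hwV, ?_⟩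
    rw [SetLike.mem_coe, Submodule.mem_comap, lead_eq_self hwV]
    exact hw
  have : FiniteDimensional ℂ (isotypicLift la τ) :=
    Submodule.finiteDimensional_of_le (isotypicLift_le_homogeneous la τ)
  have hle := le_iSup_inf_iInf_eigenspace (fun m : ℕ => hpOp (N := N) (θ : ℂ) m)
    (fun a b => commute_hpOp (θ : ℂ) a b) (isotypicLift la τ)
    (fun m f hf => ⟨hpOp_mem_domSpan _ m hf.1, by
      rw [SetLike.mem_coe, Submodule.mem_comap, lead_hpOp _ m hf.1]
      exact leadHp_mem_isotypic _ m hf.2⟩)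
    (fun m c f hf h => hpOp_apply_eq_smul hθ m c (isotypicLift_le_homogeneous la τ hf) h)
  -- As `w` itself belongs to the lift, its decomposition into joint eigenvectors expresses `w` by
  -- their leading parts.
  rw [← lead_eq_self hwV]
  suffices (⨆ χ : ℕ → ℂ, isotypicLift la τ ⊓ ⨅ m, (hpOp (θ : ℂ) m).eigenspace (χ m)) ≤
    (Submodule.span ℂ {v | ∃ f ∈ isotypicLift la τ,
      (∀ m, ∃ c : ℂ, hpOp (θ : ℂ) m f = c • f) ∧ lead ℂ la f = v}).comap (lead ℂ la) from
    this (hle hwL)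
  refine iSup_le fun χ f hf => Submodule.subset_span ⟨f, hf.1, fun m => ⟨χ m, ?_⟩, rfl⟩
  exact Module.End.mem_eigenspace_iff.mp ((Submodule.mem_iInf _).mp hf.2 m)

theorem exists_fun_of_span_eq {K M : Type*} [DivisionRing K] [AddCommGroup M] [Module K M]
    {s : Set M} {W : Submodule K M} [FiniteDimensional K W] (h : Submodule.span K s = W) :
    ∃ v : Fin (Module.finrank K W) → M, (∀ i, v i ∈ s) ∧ Submodule.span K (Set.range v) = W ∧
      LinearIndependent K v := by
  subst h
  obtain ⟨v, hv, hspan, hli⟩ := Submodule.exists_fun_fin_finrank_span_eq K s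
  exact ⟨v, hv, hspan, hli⟩

theorem exists_eigenfunctions {θ : ℝ} (hθ : 0 < θ) (la : Part N) (τ : IrrepClass ℂ N) :
    ∃ F : Fin (Module.finrank ℂ (isotypic la τ)) → MvPolynomial (Fin N) ℂ,
      (∀ i, IsJointEigenfunction (θ : ℂ) (F i) ∧ F i ∈ isotypicLift la τ) ∧
      isotypic la τ ≤ Submodule.span ℂ (Set.range fun i => lead ℂ la (F i)) := by
  obtain ⟨v, hv, hspan, hli⟩ := exists_fun_of_span_eq (span_lead_eq_isotypic hθ la τ)
  choose F hF hE hlead using hv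
  refine ⟨F, fun i => ⟨⟨fun h0 => ?_, fun m _ => hE i m⟩, hF i⟩, ?_⟩
  · refine hli.ne_zero i ?_
    rw [← hlead i, h0, map_zero]
  · simp only [hlead]
    exact hspan.ge

theorem exists_isEigensystem {θ : ℝ} (hθ : 0 < θ) :
    ∃ F : Family ℂ N, IsEigensystem (θ : ℂ) F := by
  choose F hF hspan using fun (la : Part N) (τ : IrrepClass ℂ N) =>
    exists_eigenfunctions hθ la τ
  refine ⟨F, fun la τ i => (hF la τ i).1,
    fun la τ i => isHomogeneous_of_mem_domSpan (hF la τ i).2.1,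
    fun la τ i γ hγ => (hF la τ i).2.1 hγ, fun la τ i => (hF la τ i).2.2, ?_⟩
  set S := Submodule.span ℂ {f | ∃ la τ i, f = F la τ i} with hS
  have hFS : ∀ la τ i, F la τ i ∈ S := fun la τ i => Submodule.subset_span ⟨la, τ, i, rfl⟩
  -- Induction from the bottom: some `g` in `S` has the same leading part as `f`, and the difference
  -- is strictly lower.
  have hdom : ∀ la, domSpan ℂ la ≤ S := by
    intro la
    induction la using Dominated.induction_down with
    | h la ih =>
    intro f hf
    have hV : V ℂ la ≤ (S ⊓ domSpan ℂ la).map (lead ℂ la) := by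
      refine (V_le_iSup_isotypic la).trans (iSup_le fun τ => (hspan la τ).trans ?_)
      rw [Submodule.span_le]
      rintro _ ⟨i, rfl⟩
      exact ⟨F la τ i, ⟨hFS la τ i, (hF la τ i).2.1⟩, rfl⟩
    obtain ⟨g, ⟨hgS, hgdom⟩, hg⟩ := hV (lead_mem_V la f)
    have hlow : f - g ∈ lowSpan ℂ la :=
      mem_lowSpan_of_lead_eq_zero (Submodule.sub_mem _ hf hgdom) (by rw [map_sub, hg, sub_self])
    have hlowS : lowSpan ℂ la ≤ S := restrictSupport_induction fun γ hγ =>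
      ih (sortDesc γ) hγ.1 hγ.2 (V_le_domSpan _ (monomial_mem_V γ))
    rw [← sub_add_cancel f g]
    exact S.add_mem (hlowS hlow) hgS
  rw [eq_top_iff, ← restrictSupport_univ]
  exact restrictSupport_induction fun γ _ =>
    hdom (sortDesc γ) (V_le_domSpan _ (monomial_mem_V γ))

end Existence

end

end HeckmanPolychronakos

/-! ### Existence and the eigenvalue formula -/

theorem theorem5p1 (N : ℕ) (hN : 1 ≤ N) :
    (∀ θ : ℝ, 0 < θ → ∃ F : HeckmanPolychronakos.Family ℂ N,
      HeckmanPolychronakos.IsEigensystem (θ : ℂ) F) ∧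
    ∀ (K : Type*) [Field K] [IsAlgClosed K] [CharZero K] (θ : K)
      (F : HeckmanPolychronakos.Family K N), HeckmanPolychronakos.IsEigensystem θ F →
      ∀ la : HeckmanPolychronakos.Part N, StrictAnti la.1 →
      ∀ (τ : HeckmanPolychronakos.IrrepClass K N) (m : ℕ), 1 ≤ m →
      ∀ eig : Fin (Module.finrank K (HeckmanPolychronakos.isotypic la τ)) → K,
        (∀ i, HeckmanPolychronakos.hpOp θ m (F la τ i) = eig i • F la τ i) →
        ∑ i, eig i = (τ.dim : K) * ∑ k ∈ Finset.Icc 1 (min (m + 1) N),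
          (-θ) ^ (k - 1) *
            HeckmanPolychronakos.hSub k (m + 1 - k) (HeckmanPolychronakos.shifted θ la) *
            τ.char (HeckmanPolychronakos.firstCycle N k) :=
  ⟨fun _ hθ => HeckmanPolychronakos.exists_isEigensystem hθ,
    fun _ _ _ _ θ _ hF _ hla τ m _ eig heig =>
      HeckmanPolychronakos.IsEigensystem.sum_eigenvalues θ hF hla τ m eig heig⟩
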